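/- For $g\in L^2(\mathbb C)$ and $m,n\in\mathbb Z$ let $g_{m,n}(z)=e^{2\pi i(nx-my)}\,g(z-m-in)$, $z=x+iy$. Let $Z=\frac{d}{dz}+\frac12\bar z$ and $\bar Z=\frac{d}{d\bar z}-\frac12 z$, taken in the sense of distributions, where $\frac{d}{dz}=\frac12(\partial_x-i\partial_y)$ and $\frac{d}{d\bar z}=\frac12(\partial_x+i\partial_y)$; "$Zg\in L^2(\mathbb C)$" means that the distribution $Zg$ is given by a function in $L^2(\mathbb C)$. Let $Q=[0,1)\times[0,1)\subset\mathbb C$, and let $$Z^tg(z,w)=\sum_{k\in\mathbb Z+i\mathbb Z}g(z-k)\,e^{2\pi i\,\mathrm{Im}(w\bar k)}$$ be the twisted Zak transform, the series converging in $L^2(Q\times Q)$. **Theorem.** Let $g,\tilde g\in L^2(\mathbb C)$, and assume one of the following. (a) For some closed subspace $V\subseteq L^2(\mathbb C)$ (for instance $V=L^2(\mathbb C)$), $\{g_{m,n}\}$ is an exact frame for $V$: $g_{m,n}\in V$ for all $m,n$, there are $A,B>0$ with $A\|f\|^2\le\sum_{m,n}|\langle f,g_{m,n}\rangle|^2\le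 B\|f\|^2$ for all $f\in V$, and this fails for all choices of $A,B>0$ as soon as a single element $g_{m_0,n_0}$ is deleted. Moreover $\tilde g$ is the dual function: $\tilde g\in V$ and $f=\sum_{m,n}\langle f,g_{m,n}\rangle\,\tilde g_{m,n}=\sum_{m,n}\langle f,\tilde g_{m,n}\rangle\, g_{m,n}$ (unconditionally in $L^2$) for all $f\in V$. (b) There are $A,B>0$ with $A\le|Z^tg|^2\le B$ a.e. on $Q\times Q$, and $Z^t\tilde g=1/\overline{Z^tg}$ a.e. on $Q\times Q$. Then $$\bar Zg\in L^2(\mathbb C)\iff Z\tilde g\in L^2(\mathbb C)\qquad\text{and}\qquad Zg\in L^2(\mathbb C)\iff\bar Z\tilde g\in L^2(\mathbb C).$$ -/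

import Mathlib

open MeasureTheory Filter Topology ComplexConjugate
open scoped ContDiff

noncomputable section

/-! ### Frames -/

/-- `f` is a frame for the subspace `V` of a complex Hilbert space. With `V = ⊤` this is a frame
for the whole space. Mathlib's inner product is conjugate-linear in its first argument. -/
def IsFrameFor {H : Type*} [NormedAddCommGroup H] [InnerProductSpace ℂ H]
    {ι : Type*} (V : Submodule ℂ H) (f : ι → H) : Prop :=
  (∀ i, f i ∈ V) ∧
  ∃ A B : ℝ, 0 < A ∧ 0 < B ∧ ∀ x ∈ V,
    Summable (fun i => ‖inner ℂ (f i) x‖ ^ 2) ∧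
    A * ‖x‖ ^ 2 ≤ ∑' i, ‖inner ℂ (f i) x‖ ^ 2 ∧
    ∑' i, ‖inner ℂ (f i) x‖ ^ 2 ≤ B * ‖x‖ ^ 2

/-- An exact frame for `V`: it ceases to be a frame for `V` when any single element is deleted. -/
def IsExactFrameFor {H : Type*} [NormedAddCommGroup H] [InnerProductSpace ℂ H]
    {ι : Type*} (V : Submodule ℂ H) (f : ι → H) : Prop :=
  IsFrameFor V f ∧ ∀ j : ι, ¬ IsFrameFor V (fun i : {i : ι // i ≠ j} => f i)

/-! ### Twisted translations on `L²(ℂ)` -/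

/-- The Hilbert space `L²(ℂ)` with respect to Lebesgue measure `dx dy`. -/
abbrev L2C : Type := Lp ℂ 2 (volume : Measure ℂ)

/-- The lattice point `k₁ + i k₂`. -/
def latticePoint (k : ℤ × ℤ) : ℂ := (k.1 : ℂ) + (k.2 : ℂ) * Complex.I

/-- `z = x + iy ↦ exp(2πi(nx - my)) f(x - m, y - n)`, where `k = (m, n)`. -/
def twistedTranslateFun (k : ℤ × ℤ) (f : ℂ → ℂ) (z : ℂ) : ℂ :=
  Complex.exp (((2 * Real.pi * ((k.2 : ℝ) * z.re - (k.1 : ℝ) * z.im) : ℝ) : ℂ) * Complex.I) *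
    f (z - latticePoint k)

theorem memLp_twistedTranslateFun (k : ℤ × ℤ) (g : L2C) :
    MemLp (twistedTranslateFun k g) 2 (volume : Measure ℂ) := by
  have h1 : MemLp (fun z : ℂ => g (z - latticePoint k)) 2 (volume : Measure ℂ) :=
    (Lp.memLp g).comp_measurePreserving (measurePreserving_sub_right volume (latticePoint k))
  refine h1.of_le ?_ (Eventually.of_forall fun z => ?_)
  · refine AEStronglyMeasurable.mul (Continuous.aestronglyMeasurable ?_) h1.1
    fun_prop
  · rw [twistedTranslateFun, norm_mul, Complex.norm_exp_ofReal_mul_I, one_mul]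

/-- The twisted translate of `g` by `k = (m, n)`, as an element of `L²(ℂ)`. -/
def twistedTranslate (k : ℤ × ℤ) (g : L2C) : L2C :=
  (memLp_twistedTranslateFun k g).toLp (twistedTranslateFun k g)

/-- `gd` is a dual function of `g` in `V`: the twisted translates of `gd` form a dual frame of the
twisted translates of `g`. -/
def IsDualFunction (V : Submodule ℂ L2C) (g gd : L2C) : Prop :=
  gd ∈ V ∧ ∀ f ∈ V,
    HasSum (fun k : ℤ × ℤ =>
      (inner ℂ (twistedTranslate k g) f : ℂ) • twistedTranslate k gd) f ∧
    HasSum (fun k : ℤ × ℤ =>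
      (inner ℂ (twistedTranslate k gd) f : ℂ) • twistedTranslate k g) f

/-! ### The operators `Z = d/dz + z̄/2` and `Z̄ = d/dz̄ - z/2`, in the sense of distributions -/

/-- `d/dz = (∂x - i ∂y)/2`. -/
def wirtinger (φ : ℂ → ℂ) (z : ℂ) : ℂ :=
  (fderiv ℝ φ z 1 - Complex.I * fderiv ℝ φ z Complex.I) / 2

/-- `d/dz̄ = (∂x + i ∂y)/2`. -/
def wirtingerBar (φ : ℂ → ℂ) (z : ℂ) : ℂ :=
  (fderiv ℝ φ z 1 + Complex.I * fderiv ℝ φ z Complex.I) / 2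

/-- `Z g ∈ L²(ℂ)`: the distribution `Z g` is represented by some `h ∈ L²(ℂ)`. -/
def ZMemL2 (g : L2C) : Prop :=
  ∃ h : L2C, ∀ φ : ℂ → ℂ, ContDiff ℝ ∞ φ → HasCompactSupport φ →
    ∫ z, g z * (-wirtinger φ z + conj z / 2 * φ z) = ∫ z, h z * φ z

/-- `Z̄ g ∈ L²(ℂ)`: the distribution `Z̄ g` is represented by some `h ∈ L²(ℂ)`. -/
def ZbarMemL2 (g : L2C) : Prop :=
  ∃ h : L2C, ∀ φ : ℂ → ℂ, ContDiff ℝ ∞ φ → HasCompactSupport φ →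
    ∫ z, g z * (-wirtingerBar φ z - z / 2 * φ z) = ∫ z, h z * φ z

/-! ### The twisted Zak transform -/

/-- The half-open unit square in `ℂ`. -/
def unitSquare : Set ℂ := {z | z.re ∈ Set.Ico (0 : ℝ) 1 ∧ z.im ∈ Set.Ico (0 : ℝ) 1}

/-- Lebesgue measure on `Q × Q`, where `Q` is the unit square. -/
def zakMeasure : Measure (ℂ × ℂ) := volume.restrict (unitSquare ×ˢ unitSquare)

/-- `(z, w) ↦ f(z - k) exp(2πi Im(w k̄))`. -/
def zakTerm (f : ℂ → ℂ) (k : ℤ × ℤ) (p : ℂ × ℂ) : ℂ :=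
  f (p.1 - latticePoint k) *
    Complex.exp (((2 * Real.pi * (p.2 * conj (latticePoint k)).im : ℝ) : ℂ) * Complex.I)

/-- `G` is the twisted Zak transform of `f` on `Q × Q`: the series
`∑ₖ f(z - k) exp(2πi Im(w k̄))` over the Gaussian integers converges to `G` in `L²(Q × Q)`. -/
def IsTwistedZak (f : L2C) (G : ℂ × ℂ → ℂ) : Prop :=
  MemLp G 2 zakMeasure ∧
  Tendsto (fun s : Finset (ℤ × ℤ) =>
    eLpNorm (fun p => G p - ∑ k ∈ s, zakTerm f k p) 2 zakMeasure) atTop (𝓝 0)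

end

noncomputable section

/-! ### Weyl operators -/

/-! All four conditions express one kind of regularity. The Weyl operators W_v are isometries of L²,
and their generators in the directions 1 and i combine to Z and Z̄. For test functions ‖Z̄u‖² =
‖Zu‖² + ‖u‖² (`integral_norm_classicalZ_neg`), a form of the canonical commutation relation, so
either operator controls the generators in every direction. Hence Zg ∈ L² and Z̄g ∈ L² are both
equivalent to `WeylLip g`, that is, to ‖W_v g - g‖ ≤ C‖v‖. One implication takes a weak limit of
difference quotients (`WeylLip.exists_weak_deriv`); the other applies an a priori estimate to
mollified cutoffs of g (`IsWeakZ.weylLip`). The distinction between Z and Z̄ disappears, and it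
remains to see that g is Lipschitz in this sense iff its dual is.

W_v commutes with twisted translates up to unimodular constants, so it carries the pair (g, dual) to
another such pair with the same bounds. It therefore suffices that passing to the dual is Lipschitz
with a constant independent of v. The model is the identity |1/x̄ - 1/ȳ| = |x - y| / (|x||y|).

In case (b) the identity is used pointwise. The values of g along z minus the lattice are Fourier
coefficients of a function f on the torus, those of the dual belong to 1/f̄, and W_v acts on such
fibers by a scalar and a translation of the torus; Parseval does the rest (`IsZakFiber.tsum_le`,
`weylLip_of_ae_isZakFiberAt`).

In case (a) exactness makes the frame a Riesz sequence (`IsExactFrameFor.exists_biorthogonal`). The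
twisted translates have shift-invariant Gram matrices, so all Gram operators are Toeplitz over ℤ²
and commute. The same identity then holds with operators in place of numbers
(`IsRieszDual.norm_sub_le`). -/

/-- The Weyl operator `f ↦ exp(i Im(z̄ v)) f(z + v)`. -/
def weylFun (v : ℂ) (f : ℂ → ℂ) (z : ℂ) : ℂ :=
  Complex.exp ((((conj z * v).im : ℝ) : ℂ) * Complex.I) * f (z + v)

theorem norm_weylFun (v : ℂ) (f : ℂ → ℂ) (z : ℂ) : ‖weylFun v f z‖ = ‖f (z + v)‖ := by
  rw [weylFun, norm_mul, Complex.norm_exp_ofReal_mul_I, one_mul]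

theorem aestronglyMeasurable_weylFun (v : ℂ) {f : ℂ → ℂ}
    (hf : AEStronglyMeasurable f (volume : Measure ℂ)) :
    AEStronglyMeasurable (weylFun v f) (volume : Measure ℂ) := by
  refine AEStronglyMeasurable.mul (Continuous.aestronglyMeasurable ?_)
    (hf.comp_measurePreserving (measurePreserving_add_right volume v))
  fun_prop

theorem memLp_weylFun (v : ℂ) {f : ℂ → ℂ} (hf : MemLp f 2 (volume : Measure ℂ)) :
    MemLp (weylFun v f) 2 (volume : Measure ℂ) :=
  (hf.comp_measurePreserving (measurePreserving_add_right volume v)).of_le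
    (aestronglyMeasurable_weylFun v hf.1) (Eventually.of_forall fun z => (norm_weylFun v f z).le)

theorem weylFun_ae_congr (v : ℂ) {f f' : ℂ → ℂ} (h : f =ᵐ[volume] f') :
    weylFun v f =ᵐ[volume] weylFun v f' := by
  filter_upwards [(measurePreserving_add_right volume v).quasiMeasurePreserving.ae_eq_comp h]
    with z hz
  simp only [Function.comp_apply] at hz
  simp only [weylFun, hz]

/-- The Weyl operator on `L²(ℂ)`. -/
def weyl (v : ℂ) (g : L2C) : L2C := (memLp_weylFun v (Lp.memLp g)).toLp (weylFun v g)

theorem coeFn_weyl (v : ℂ) (g : L2C) : weyl v g =ᵐ[volume] weylFun v g := MemLp.coeFn_toLp _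

/-- `g` is Lipschitz along the Weyl operators. -/
def WeylLip (g : L2C) : Prop := ∃ C : ℝ, 0 ≤ C ∧ ∀ v, ‖weyl v g - g‖ ≤ C * ‖v‖

theorem enorm_weyl_sub (v : ℂ) (g : L2C) :
    ENNReal.ofReal ‖weyl v g - g‖ = eLpNorm (fun z => weylFun v g z - g z) 2 volume := by
  rw [ofReal_norm, Lp.enorm_def]
  refine eLpNorm_congr_ae ?_
  filter_upwards [Lp.coeFn_sub (weyl v g) g, coeFn_weyl v g] with z h1 h2
  rw [h1, Pi.sub_apply, h2]

/-! ### Weak limits -/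

/-- A bounded sequence in a Hilbert space has a vector that pairs like the limit with every test
vector along which the sequence converges weakly. -/
theorem exists_weak_limit {H : Type*} [NormedAddCommGroup H] [InnerProductSpace ℂ H]
    [CompleteSpace H] (u : ℕ → H) (C : ℝ) (hu : ∀ n, ‖u n‖ ≤ C) :
    ∃ h : H, ∀ (w : H) (c : ℂ), Tendsto (fun n => inner ℂ (u n) w) atTop (𝓝 c) →
      inner ℂ h w = c := by
  have hK := WeakDual.isCompact_closedBall (𝕜 := ℂ) (E := H) 0 C
  let F : ℕ → WeakDual ℂ H := fun n => StrongDual.toWeakDual (InnerProductSpace.toDual ℂ H (u n))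
  -- Banach–Alaoglu along one fixed ultrafilter: a single limit serves every test vector, without
  -- separability or subsequences.
  obtain ⟨x, -, hx⟩ := hK.ultrafilter_le_nhds ((Filter.hyperfilter ℕ).map F) (by
    refine Filter.le_principal_iff.2 (Filter.mem_map.2 (Filter.univ_mem' fun n => ?_))
    simpa [F] using hu n)
  refine ⟨(InnerProductSpace.toDual ℂ H).symm (WeakDual.toStrongDual x), fun w c hc => ?_⟩
  have h1 : Tendsto (fun n => F n w) (Filter.hyperfilter ℕ) (𝓝 (x w)) :=
    ((WeakDual.eval_continuous (𝕜 := ℂ) w).tendsto x).comp hx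
  have h2 : Tendsto (fun n => F n w) (Filter.hyperfilter ℕ) (𝓝 c) :=
    hc.mono_left Nat.hyperfilter_le_atTop
  rw [InnerProductSpace.toDual_symm_apply]
  exact tendsto_nhds_unique h1 h2

/-- The integral of a product of square integrable functions as an inner product. -/
theorem integral_mul_eq_inner (g : L2C) {φ : ℂ → ℂ} (hφ : MemLp φ 2 (volume : Measure ℂ)) :
    ∫ z, g z * φ z = inner ℂ (hφ.star.toLp (star φ)) g := by
  rw [L2.inner_def]
  refine integral_congr_ae ?_
  filter_upwards [MemLp.coeFn_toLp hφ.star] with z hz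
  rw [hz]
  simp [RCLike.inner_apply]

/-! ### From Weyl–Lipschitz functions to weak derivatives -/

/-- The transpose of the Weyl operator. -/
def weylTranspose (v : ℂ) (φ : ℂ → ℂ) (z : ℂ) : ℂ :=
  Complex.exp ((((conj z * v).im : ℝ) : ℂ) * Complex.I) * φ (z - v)

/-- Substituting z - v for z leaves the phase alone because conj v * v is real. -/
theorem integral_weylFun_mul (v : ℂ) (f φ : ℂ → ℂ) :
    ∫ z, weylFun v f z * φ z = ∫ z, f z * weylTranspose v φ z := by
  rw [← integral_sub_right_eq_self _ v]
  refine integral_congr_ae (Eventually.of_forall fun z => ?_)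
  have h : (conj (z - v) * v).im = (conj z * v).im := by
    simp [Complex.mul_im]; ring
  simp only [weylFun, weylTranspose, h, sub_add_cancel]
  ring

theorem hasDerivAt_weylTranspose {φ : ℂ → ℂ} (hφ : Differentiable ℝ φ) (v z : ℂ) :
    HasDerivAt (fun s : ℝ => weylTranspose (s • v) φ z)
      (-(fderiv ℝ φ z v) + ((conj z * v).im : ℂ) * Complex.I * φ z) 0 := by
  have h1 : HasDerivAt (fun s : ℝ => φ (z - s • v)) (-(fderiv ℝ φ z v)) 0 := by
    have h2 : HasDerivAt (fun s : ℝ => z - s • v) (-v) 0 := by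
      simpa using (((hasDerivAt_id (0 : ℝ)).smul_const v).const_sub z)
    have h3 : HasFDerivAt φ (fderiv ℝ φ z) (z - (0 : ℝ) • v) := by
      simpa using (hφ z).hasFDerivAt
    simpa [Function.comp_def] using h3.comp_hasDerivAt (0 : ℝ) h2
  have h4 : HasDerivAt (fun s : ℝ => Complex.exp (((s * (conj z * v).im : ℝ) : ℂ) * Complex.I))
      (((conj z * v).im : ℂ) * Complex.I) 0 := by
    have h5 : HasDerivAt (fun s : ℝ => ((s * (conj z * v).im : ℝ) : ℂ) * Complex.I)
        (((conj z * v).im : ℂ) * Complex.I) 0 := by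
      refine HasDerivAt.mul_const ?_ _
      simpa using ((hasDerivAt_id (0 : ℝ)).mul_const (conj z * v).im).ofReal_comp
    simpa using h5.cexp
  have h6 := h4.mul h1
  refine (h6.congr_deriv ?_).congr_of_eventuallyEq (Eventually.of_forall fun s => ?_)
  · simp; ring
  · have : (conj z * s • v).im = s * (conj z * v).im := by
      simp [Complex.mul_im]; ring
    simp only [weylTranspose, this, Pi.mul_apply]

/-- Difference quotients of a test function under the transposed Weyl operators are bounded and
supported in a fixed ball. -/
theorem exists_bound_weylTranspose_sub {φ : ℂ → ℂ} (hφ : ContDiff ℝ ∞ φ)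
    (hc : HasCompactSupport φ) (v : ℂ) :
    ∃ R M : ℝ, ∀ s : ℝ, 0 < s → s ≤ 1 → ∀ z,
      ‖weylTranspose (s • v) φ z - φ z‖ ≤
        s * Set.indicator (Metric.closedBall (0 : ℂ) R) (fun _ => M) z := by
  obtain ⟨L, hL⟩ := hφ.lipschitzWith_of_hasCompactSupport hc (by simp)
  obtain ⟨B, hB⟩ := hφ.continuous.bounded_above_of_compact_support hc
  obtain ⟨R, hR⟩ := hc.isCompact.isBounded.subset_closedBall (0 : ℂ)
  have h0 : ∀ z : ℂ, R < ‖z‖ → φ z = 0 := fun z hz => by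
    by_contra h
    have := hR (subset_tsupport φ h)
    simp at this
    linarith
  -- Since s ≤ 1, the translate by s • v is supported in the ball enlarged by ‖v‖. The first summand
  -- bounds the change of the phase on that ball, the second the change of φ.
  refine ⟨R + ‖v‖, (R + ‖v‖) * ‖v‖ * B + L * ‖v‖, fun s hs hs1 z => ?_⟩
  have hsv : ‖s • v‖ ≤ ‖v‖ := by
    rw [norm_smul, Real.norm_of_nonneg hs.le]
    exact mul_le_of_le_one_left (norm_nonneg v) hs1
  by_cases hz : z ∈ Metric.closedBall (0 : ℂ) (R + ‖v‖)
  · rw [Set.indicator_of_mem hz]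
    rw [mem_closedBall_zero_iff] at hz
    have e1 : weylTranspose (s • v) φ z - φ z =
        (Complex.exp (Complex.I * (((conj z * s • v).im : ℝ) : ℂ)) - 1) * φ (z - s • v) +
          (φ (z - s • v) - φ z) := by
      rw [weylTranspose, mul_comm Complex.I]; ring
    have e2 : ‖Complex.exp (Complex.I * (((conj z * s • v).im : ℝ) : ℂ)) - 1‖ ≤
        s * ((R + ‖v‖) * ‖v‖) := by
      refine (Real.norm_exp_I_mul_ofReal_sub_one_le).trans ?_
      rw [Real.norm_eq_abs]
      refine (Complex.abs_im_le_norm _).trans ?_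
      rw [norm_mul, norm_smul, Real.norm_of_nonneg hs.le, Complex.norm_conj]
      have : ‖z‖ * (s * ‖v‖) = s * (‖z‖ * ‖v‖) := by ring
      rw [this]
      gcongr
    have e3 : ‖φ (z - s • v) - φ z‖ ≤ s * (L * ‖v‖) := by
      have := hL.dist_le_mul (z - s • v) z
      rw [dist_eq_norm, dist_eq_norm, sub_sub_cancel_left, norm_neg, norm_smul,
        Real.norm_of_nonneg hs.le] at this
      linarith
    rw [e1]
    refine (norm_add_le _ _).trans ?_
    rw [norm_mul]
    have := mul_le_mul e2 (hB (z - s • v)) (norm_nonneg _) ((norm_nonneg _).trans e2)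
    linarith
  · rw [Set.indicator_of_notMem hz]
    rw [mem_closedBall_zero_iff, not_le] at hz
    have e1 : φ z = 0 := h0 z (by linarith [norm_nonneg v])
    have e2 : φ (z - s • v) = 0 := h0 _ (by linarith [norm_sub_norm_le z (s • v)])
    rw [weylTranspose, e1, e2]; simp

theorem memLp_two_of_contDiff_hasCompactSupport {φ : ℂ → ℂ} (hφ : ContDiff ℝ ∞ φ)
    (hc : HasCompactSupport φ) : MemLp φ 2 (volume : Measure ℂ) :=
  hφ.continuous.memLp_of_hasCompactSupport hc

theorem integrable_lp_mul (g : L2C) {φ : ℂ → ℂ} (hφ : MemLp φ 2 (volume : Measure ℂ)) :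
    Integrable (fun z => g z * φ z) :=
  (Lp.memLp g).integrable_mul hφ

theorem memLp_weylTranspose (v : ℂ) {φ : ℂ → ℂ} (hφ : MemLp φ 2 (volume : Measure ℂ)) :
    MemLp (weylTranspose v φ) 2 (volume : Measure ℂ) := by
  have h1 := hφ.comp_measurePreserving (measurePreserving_sub_right volume v)
  refine h1.of_le (AEStronglyMeasurable.mul (Continuous.aestronglyMeasurable ?_) h1.1)
    (Eventually.of_forall fun z => ?_)
  · fun_prop
  · rw [weylTranspose, norm_mul, Complex.norm_exp_ofReal_mul_I, one_mul]; rfl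

theorem WeylLip.exists_weak_deriv {g : L2C} (hg : WeylLip g) (v : ℂ) :
    ∃ h : L2C, ∀ φ : ℂ → ℂ, ContDiff ℝ ∞ φ → HasCompactSupport φ →
      ∫ z, g z * (-(fderiv ℝ φ z v) + ((conj z * v).im : ℂ) * Complex.I * φ z) =
        ∫ z, h z * φ z := by
  obtain ⟨C, hC0, hC⟩ := hg
  let s : ℕ → ℝ := fun n => 1 / ((n : ℝ) + 1)
  have hs0 : ∀ n, 0 < s n := fun n => Nat.one_div_pos_of_nat
  have hs1 : ∀ n, s n ≤ 1 := fun n => by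
    simpa [s] using Nat.one_div_le_one_div (α := ℝ) (Nat.zero_le n)
  have hs : Tendsto s atTop (𝓝 0) := tendsto_one_div_add_atTop_nhds_zero_nat
  -- The Lipschitz condition says precisely that these difference quotients stay bounded. Their
  -- pairings with a test function converge after transposition, by dominated convergence.
  let u : ℕ → L2C := fun n => ((s n : ℂ))⁻¹ • (weyl (s n • v) g - g)
  have hu : ∀ n, ‖u n‖ ≤ C * ‖v‖ := fun n => by
    have := hC (s n • v)
    rw [norm_smul, Real.norm_of_nonneg (hs0 n).le] at this
    rw [norm_smul, norm_inv, Complex.norm_real, Real.norm_of_nonneg (hs0 n).le,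
      inv_mul_le_iff₀ (hs0 n)]
    linarith
  obtain ⟨h, hh⟩ := exists_weak_limit u _ hu
  refine ⟨h, fun φ hφ hc => ?_⟩
  have hφ2 := memLp_two_of_contDiff_hasCompactSupport hφ hc
  rw [integral_mul_eq_inner h hφ2, ← inner_conj_symm, hh _ (conj (∫ z, g z * (-(fderiv ℝ φ z v) +
    ((conj z * v).im : ℂ) * Complex.I * φ z))), Complex.conj_conj]
  have key : ∀ n, inner ℂ (u n) (hφ2.star.toLp (star φ)) =
      conj (∫ z, g z * ((s n : ℂ)⁻¹ * (weylTranspose (s n • v) φ z - φ z))) := fun n => by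
    rw [← inner_conj_symm, inner_smul_right, inner_sub_right, ← integral_mul_eq_inner _ hφ2,
      ← integral_mul_eq_inner _ hφ2]
    congr 1
    have e1 : ∫ z, weyl (s n • v) g z * φ z = ∫ z, g z * weylTranspose (s n • v) φ z := by
      rw [← integral_weylFun_mul]
      refine integral_congr_ae ?_
      filter_upwards [coeFn_weyl (s n • v) g] with z hz
      rw [hz]
    rw [e1, ← integral_sub (integrable_lp_mul g (memLp_weylTranspose _ hφ2))
      (integrable_lp_mul g hφ2), ← integral_const_mul]
    refine integral_congr_ae (Eventually.of_forall fun z => ?_)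
    simp only
    ring
  simp_rw [key]
  refine (Complex.continuous_conj.tendsto _).comp ?_
  obtain ⟨R, M, hRM⟩ := exists_bound_weylTranspose_sub hφ hc v
  refine tendsto_integral_of_dominated_convergence
    (Set.indicator (Metric.closedBall (0 : ℂ) R) (fun z => ‖g z‖ * M)) (fun n => ?_) ?_
    (fun n => Eventually.of_forall fun z => ?_) (Eventually.of_forall fun z => ?_)
  · exact (Lp.aestronglyMeasurable g).mul
      (((memLp_weylTranspose _ hφ2).1.sub hφ2.1).const_mul _)
  · rw [integrable_indicator_iff measurableSet_closedBall]
    refine Integrable.mul_const ?_ M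
    exact (((Lp.memLp g).locallyIntegrable (by norm_num)).integrableOn_isCompact
      (isCompact_closedBall _ _)).norm
  · have h1 := hRM (s n) (hs0 n) (hs1 n) z
    rw [norm_mul, norm_mul, norm_inv, Complex.norm_real, Real.norm_of_nonneg (hs0 n).le]
    have h2 : (s n)⁻¹ * ‖weylTranspose (s n • v) φ z - φ z‖ ≤
        Set.indicator (Metric.closedBall (0 : ℂ) R) (fun _ => M) z := by
      rwa [inv_mul_le_iff₀ (hs0 n)]
    refine (mul_le_mul_of_nonneg_left h2 (norm_nonneg (g z))).trans_eq ?_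
    by_cases hz : z ∈ Metric.closedBall (0 : ℂ) R <;> simp [hz, Set.indicator]
  · refine Tendsto.const_mul _ ?_
    have h1 := (hasDerivAt_weylTranspose (hφ.differentiable (by simp)) v z).tendsto_slope
    have h2 : Tendsto s atTop (𝓝[≠] 0) := tendsto_nhdsWithin_iff.2
      ⟨hs, Eventually.of_forall fun n => (hs0 n).ne'⟩
    refine (h1.comp h2).congr fun n => ?_
    simp [slope, weylTranspose, Complex.real_smul]

/-- `Z_σ = (∂x - iσ∂y)/2 + (σx - iy)/2`; thus `Z_1 = Z` and `Z_{-1} = Z̄`. -/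
def IsWeakZ (σ : ℝ) (g h : L2C) : Prop :=
  ∀ φ : ℂ → ℂ, ContDiff ℝ ∞ φ → HasCompactSupport φ →
    ∫ z, g z * (-((fderiv ℝ φ z 1 - Complex.I * σ * fderiv ℝ φ z Complex.I) / 2) +
      (σ * z.re - Complex.I * z.im) / 2 * φ z) = ∫ z, h z * φ z

theorem zMemL2_iff (g : L2C) : ZMemL2 g ↔ ∃ h, IsWeakZ 1 g h := by
  refine exists_congr fun h => forall₃_congr fun φ _ _ => ?_
  refine Eq.congr (integral_congr_ae (Eventually.of_forall fun z => ?_)) rfl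
  have : conj z = (z.re : ℂ) - Complex.I * z.im := by
    apply Complex.ext <;> simp
  simp [wirtinger, this]

theorem zbarMemL2_iff (g : L2C) : ZbarMemL2 g ↔ ∃ h, IsWeakZ (-1) g h := by
  refine exists_congr fun h => forall₃_congr fun φ _ _ => ?_
  refine Eq.congr (integral_congr_ae (Eventually.of_forall fun z => ?_)) rfl
  have : z = (z.re : ℂ) + Complex.I * z.im := by
    apply Complex.ext <;> simp
  simp only [wirtingerBar]
  nth_rw 4 [this]
  push_cast
  ring

/-- Z_σ is half of the generator in direction 1 minus iσ times the one in direction i, so weak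
derivatives along the two axes suffice, for every real σ. -/
theorem WeylLip.exists_isWeakZ {g : L2C} (hg : WeylLip g) (σ : ℝ) : ∃ h, IsWeakZ σ g h := by
  obtain ⟨h1, H1⟩ := hg.exists_weak_deriv 1
  obtain ⟨h2, H2⟩ := hg.exists_weak_deriv Complex.I
  refine ⟨(1 / 2 : ℂ) • (h1 - (Complex.I * σ) • h2), fun φ hφ hc => ?_⟩
  have hφ2 := memLp_two_of_contDiff_hasCompactSupport hφ hc
  have key : ∀ v : ℂ, Integrable (fun z => g z * (-(fderiv ℝ φ z v) +
      ((conj z * v).im : ℂ) * Complex.I * φ z)) := fun v => by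
    refine integrable_lp_mul g (Continuous.memLp_of_hasCompactSupport ?_ ?_)
    · have := (hφ.continuous_fderiv (by simp)).clm_apply (continuous_const (y := v))
      have := hφ.continuous
      fun_prop
    · refine HasCompactSupport.add ?_ (hc.mul_left)
      exact ((hc.fderiv_apply (𝕜 := ℝ) v).comp_left (g := Neg.neg) neg_zero)
  have e : ∫ z, ((1 / 2 : ℂ) • (h1 - (Complex.I * σ) • h2) : L2C) z * φ z =
      1 / 2 * ((∫ z, h1 z * φ z) - Complex.I * σ * ∫ z, h2 z * φ z) := by
    rw [← integral_const_mul, ← integral_sub (integrable_lp_mul h1 hφ2)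
      ((integrable_lp_mul h2 hφ2).const_mul _), ← integral_const_mul]
    refine integral_congr_ae ?_
    filter_upwards [Lp.coeFn_smul (1 / 2 : ℂ) (h1 - (Complex.I * σ) • h2),
      Lp.coeFn_sub h1 ((Complex.I * σ) • h2), Lp.coeFn_smul (Complex.I * σ) h2] with z a b c
    rw [a, Pi.smul_apply, b, Pi.sub_apply, c, Pi.smul_apply]
    simp only [smul_eq_mul]
    ring
  rw [e, ← H1 φ hφ hc, ← H2 φ hφ hc, ← integral_const_mul, ← integral_sub (key 1)
    ((key Complex.I).const_mul _), ← integral_const_mul]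
  refine integral_congr_ae (Eventually.of_forall fun z => ?_)
  simp only [mul_one, Complex.conj_im, Complex.mul_im, Complex.conj_re, Complex.I_re, Complex.I_im,
    mul_zero, add_zero]
  push_cast
  linear_combination ((σ : ℂ) * z.re / 2 * g z * φ z) * Complex.I_sq

/-! ### Classical estimates for test functions -/

theorem eLpNorm_two_sq {α : Type*} [MeasurableSpace α] {μ : Measure α} {E : Type*}
    [NormedAddCommGroup E] (f : α → E) : eLpNorm f 2 μ ^ 2 = ∫⁻ z, ‖f z‖ₑ ^ 2 ∂μ := by
  have := eLpNorm_nnreal_pow_eq_lintegral (μ := μ) (f := f) (p := 2) (by norm_num)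
  simpa using this

theorem lintegral_sq_le_of_isProbabilityMeasure {α : Type*} [MeasurableSpace α] {μ : Measure α}
    [IsProbabilityMeasure μ] {f : α → ENNReal} (hf : AEMeasurable f μ) :
    (∫⁻ a, f a ∂μ) ^ 2 ≤ ∫⁻ a, f a ^ 2 ∂μ := by
  have h := ENNReal.lintegral_mul_le_Lp_mul_Lq μ (Real.HolderConjugate.two_two) hf
    (aemeasurable_const (b := (1 : ENNReal)))
  simp only [Pi.mul_apply, mul_one, ENNReal.one_rpow, lintegral_const, measure_univ] at h
  calc (∫⁻ a, f a ∂μ) ^ 2 ≤ ((∫⁻ a, f a ^ (2 : ℝ) ∂μ) ^ (1 / 2 : ℝ)) ^ 2 := by gcongr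
    _ = ∫⁻ a, f a ^ 2 ∂μ := by
      rw [← ENNReal.rpow_natCast, ← ENNReal.rpow_mul]
      norm_num

/-- Minkowski's inequality for averages of square integrable functions. -/
theorem lintegral_lintegral_sq_le {α β : Type*} [MeasurableSpace α] [MeasurableSpace β]
    {μ : Measure α} [IsProbabilityMeasure μ] {ν : Measure β} [SFinite ν] {F : β → α → ENNReal}
    (hF : AEMeasurable (Function.uncurry F) (ν.prod μ)) {K : ENNReal}
    (hK : ∀ a, ∫⁻ z, F z a ^ 2 ∂ν ≤ K) :
    ∫⁻ z, (∫⁻ a, F z a ∂μ) ^ 2 ∂ν ≤ K := by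
  calc ∫⁻ z, (∫⁻ a, F z a ∂μ) ^ 2 ∂ν ≤ ∫⁻ z, ∫⁻ a, F z a ^ 2 ∂μ ∂ν := by
        refine lintegral_mono_ae ?_
        filter_upwards [hF.aestronglyMeasurable.prodMk_left] with z hz
        exact lintegral_sq_le_of_isProbabilityMeasure hz.aemeasurable
    _ = ∫⁻ a, ∫⁻ z, F z a ^ 2 ∂ν ∂μ :=
        lintegral_lintegral_swap (f := fun z a => F z a ^ 2) (hF.pow_const 2)
    _ ≤ ∫⁻ _, K ∂μ := lintegral_mono hK
    _ = K := by simp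

/-- The generator of the Weyl operators in direction `v`. -/
def weylDeriv (v : ℂ) (u : ℂ → ℂ) (z : ℂ) : ℂ :=
  fderiv ℝ u z v + ((conj z * v).im : ℂ) * Complex.I * u z

theorem continuous_weylDeriv (v : ℂ) {u : ℂ → ℂ} (hu : ContDiff ℝ ∞ u) :
    Continuous (weylDeriv v u) := by
  have h1 := (hu.continuous_fderiv (by simp)).clm_apply (continuous_const (y := v))
  have h2 := hu.continuous
  unfold weylDeriv
  fun_prop

theorem hasCompactSupport_weylDeriv (v : ℂ) {u : ℂ → ℂ} (hc : HasCompactSupport u) :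
    HasCompactSupport (weylDeriv v u) :=
  (hc.fderiv_apply (𝕜 := ℝ) v).add hc.mul_left

/-- Along a fixed direction the Weyl operators form a one-parameter group, the phases adding up
because Im(v̄v) = 0. Hence the derivative at time t is the time-t operator applied to the generator.
-/
theorem hasDerivAt_weylFun_smul (v : ℂ) {u : ℂ → ℂ} (hu : Differentiable ℝ u) (z : ℂ) (t : ℝ) :
    HasDerivAt (fun s : ℝ => weylFun (s • v) u z) (weylFun (t • v) (weylDeriv v u) z) t := by
  have h1 : HasDerivAt (fun s : ℝ => u (z + s • v)) (fderiv ℝ u (z + t • v) v) t := by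
    have h2 : HasDerivAt (fun s : ℝ => z + s • v) v t := by
      simpa using (((hasDerivAt_id t).smul_const v).const_add z)
    exact (hu (z + t • v)).hasFDerivAt.comp_hasDerivAt t h2
  have h4 : HasDerivAt (fun s : ℝ => Complex.exp (((s * (conj z * v).im : ℝ) : ℂ) * Complex.I))
      (Complex.exp (((t * (conj z * v).im : ℝ) : ℂ) * Complex.I) *
        (((conj z * v).im : ℂ) * Complex.I)) t := by
    have h5 : HasDerivAt (fun s : ℝ => ((s * (conj z * v).im : ℝ) : ℂ) * Complex.I)
        (((conj z * v).im : ℂ) * Complex.I) t := by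
      refine HasDerivAt.mul_const ?_ _
      simpa using ((hasDerivAt_id t).mul_const (conj z * v).im).ofReal_comp
    exact h5.cexp
  have e : ∀ s : ℝ, (conj z * s • v).im = s * (conj z * v).im := fun s => by
    simp [Complex.mul_im]; ring
  refine ((h4.mul h1).congr_deriv ?_).congr_of_eventuallyEq (Eventually.of_forall fun s => ?_)
  · have e2 : (conj (z + t • v) * v).im = (conj z * v).im := by
      simp [Complex.mul_im]; ring
    simp only [weylFun, weylDeriv, e, e2]
    ring
  · simp only [weylFun, e, Pi.mul_apply]

/-- W_v u - u is the integral over t in (0, 1] of W_{tv} applied to the generator of u. Each W_{tv}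
preserves the L² norm, and Minkowski's inequality for the average over t finishes. -/
theorem eLpNorm_weylFun_sub_le (v : ℂ) {u : ℂ → ℂ} (hu : ContDiff ℝ ∞ u) :
    eLpNorm (fun z => weylFun v u z - u z) 2 volume ≤ eLpNorm (weylDeriv v u) 2 volume := by
  have hcont := continuous_weylDeriv v hu
  rw [← ENNReal.pow_le_pow_left_iff two_ne_zero, eLpNorm_two_sq, eLpNorm_two_sq]
  let μ : Measure ℝ := volume.restrict (Set.Ioc 0 1)
  have : IsProbabilityMeasure μ := ⟨by simp [μ]⟩
  have hF : Measurable (Function.uncurry fun (z : ℂ) (t : ℝ) => ‖weylDeriv v u (z + t • v)‖ₑ) := by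
    refine Measurable.enorm (Continuous.measurable ?_)
    exact hcont.comp (by fun_prop)
  refine le_trans (lintegral_mono fun z => ?_)
    (lintegral_lintegral_sq_le (μ := μ) (ν := volume) hF.aemeasurable fun t => ?_)
  · gcongr
    have hint : Continuous fun t : ℝ => weylFun (t • v) (weylDeriv v u) z := by
      unfold weylFun
      have := hcont.comp (show Continuous fun t : ℝ => z + t • v by fun_prop)
      simp only [Function.comp_def] at this
      fun_prop
    have h1 := intervalIntegral.integral_eq_sub_of_hasDerivAt
      (fun t _ => hasDerivAt_weylFun_smul v (hu.differentiable (by simp)) z t)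
      (hint.intervalIntegrable 0 1)
    have h2 : weylFun ((0 : ℝ) • v) u z = u z := by simp [weylFun]
    rw [one_smul, h2, intervalIntegral.integral_of_le zero_le_one] at h1
    rw [← h1]
    refine (enorm_integral_le_lintegral_enorm _).trans_eq (lintegral_congr fun t => ?_)
    rw [← ofReal_norm, norm_weylFun, ofReal_norm]
  · exact (lintegral_add_right_eq_self (fun z => ‖weylDeriv v u z‖ₑ ^ 2) (t • v)).le

/-- The operators `Z_σ` on differentiable functions. -/
def classicalZ (σ : ℝ) (u : ℂ → ℂ) (z : ℂ) : ℂ :=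
  (weylDeriv 1 u z - Complex.I * σ * weylDeriv Complex.I u z) / 2

/-- For σ = 1 the generator in direction v is vZ + v̄Z̄. For σ = ±1 alike, both coefficients have
modulus ‖v‖. -/
theorem norm_weylDeriv_le {σ : ℝ} (hσ : σ ^ 2 = 1) (v : ℂ) (u : ℂ → ℂ) (z : ℂ) :
    ‖weylDeriv v u z‖ ≤ ‖v‖ * (‖classicalZ σ u z‖ + ‖classicalZ (-σ) u z‖) := by
  have hσ' : (σ : ℂ) ^ 2 = 1 := by exact_mod_cast hσ
  have h1 : weylDeriv v u z = v.re * weylDeriv 1 u z + v.im * weylDeriv Complex.I u z := by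
    have : v = v.re • (1 : ℂ) + v.im • Complex.I := by
      simp [Complex.re_add_im]
    have e : fderiv ℝ u z v = v.re • fderiv ℝ u z 1 + v.im • fderiv ℝ u z Complex.I := by
      conv_lhs => rw [this]
      rw [map_add, map_smul, map_smul]
    simp only [weylDeriv, e, Complex.real_smul]
    simp [Complex.mul_im]
    ring
  have h2 : weylDeriv v u z = (v.re + Complex.I * σ * v.im) * classicalZ σ u z +
      (v.re - Complex.I * σ * v.im) * classicalZ (-σ) u z := by
    rw [h1]
    simp only [classicalZ, Complex.ofReal_neg]
    linear_combination (-(v.im : ℂ) * weylDeriv Complex.I u z * Complex.I ^ 2) * (-hσ') +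
      (-(v.im : ℂ) * weylDeriv Complex.I u z) * (-Complex.I_sq)
  have hn : ∀ τ : ℝ, τ ^ 2 = 1 → ‖(v.re + Complex.I * τ * v.im : ℂ)‖ = ‖v‖ := fun τ hτ => by
    have : (v.re + Complex.I * τ * v.im : ℂ) = ⟨v.re, τ * v.im⟩ := by
      apply Complex.ext <;> simp
    rw [this, Complex.norm_def, Complex.norm_def, Complex.normSq_mk, Complex.normSq_apply]
    congr 1
    linear_combination v.im ^ 2 * hτ
  have hn' := hn (-σ) (by simpa using hσ)
  rw [h2]
  refine (norm_add_le _ _).trans ?_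
  rw [norm_mul, norm_mul, hn σ hσ]
  have : (v.re - Complex.I * σ * v.im : ℂ) = v.re + Complex.I * (-σ : ℝ) * v.im := by
    push_cast; ring
  rw [this, hn', mul_add]

/-! ### Integration by parts and the commutation identity -/

theorem integral_mul_fderiv_of_hasCompactSupport {f g : ℂ → ℂ} (hf : ContDiff ℝ ∞ f)
    (hg : ContDiff ℝ ∞ g) (hc : HasCompactSupport g) (v : ℂ) :
    ∫ z, f z * fderiv ℝ g z v = -∫ z, fderiv ℝ f z v * g z := by
  have hf' := (hf.continuous_fderiv (by simp)).clm_apply (continuous_const (y := v))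
  have hg' := (hg.continuous_fderiv (by simp)).clm_apply (continuous_const (y := v))
  refine integral_mul_fderiv_eq_neg_fderiv_mul_of_integrable ?_ ?_ ?_
    (fun z _ => hf.differentiable (by simp) z) (fun z _ => hg.differentiable (by simp) z)
  · exact (hf'.mul hg.continuous).integrable_of_hasCompactSupport hc.mul_left
  · exact (hf.continuous.mul hg').integrable_of_hasCompactSupport
      (hc.fderiv_apply (𝕜 := ℝ) v).mul_left
  · exact (hf.continuous.mul hg.continuous).integrable_of_hasCompactSupport hc.mul_left

theorem contDiff_conj_comp {u : ℂ → ℂ} (hu : ContDiff ℝ ∞ u) :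
    ContDiff ℝ ∞ (fun z => conj (u z)) :=
  Complex.conjCLE.contDiff.comp hu

theorem fderiv_conj_comp {u : ℂ → ℂ} (hu : Differentiable ℝ u) (z v : ℂ) :
    fderiv ℝ (fun z => conj (u z)) z v = conj (fderiv ℝ u z v) := by
  have := (Complex.conjCLE.toContinuousLinearMap.hasFDerivAt.comp z (hu z).hasFDerivAt).fderiv
  have e : (fun z => conj (u z)) = Complex.conjCLE.toContinuousLinearMap ∘ u := by
    ext z; simp
  rw [e, this]
  simp

theorem contDiff_fderiv_apply {u : ℂ → ℂ} (hu : ContDiff ℝ ∞ u) (v : ℂ) :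
    ContDiff ℝ ∞ (fun z => fderiv ℝ u z v) :=
  (hu.fderiv_right (m := ∞) (by simp)).clm_apply contDiff_const

theorem fderiv_fderiv_apply_comm {u : ℂ → ℂ} (hu : ContDiff ℝ ∞ u) (v w z : ℂ) :
    fderiv ℝ (fun z => fderiv ℝ u z v) z w = fderiv ℝ (fun z => fderiv ℝ u z w) z v := by
  have h1 : DifferentiableAt ℝ (fderiv ℝ u) z :=
    (hu.fderiv_right (m := ∞) (by simp)).differentiable (by simp) z
  have h2 : ∀ v w : ℂ, fderiv ℝ (fun z => fderiv ℝ u z v) z w = fderiv ℝ (fderiv ℝ u) z w v :=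
    fun v w => by
      rw [fderiv_clm_apply h1 (differentiableAt_const v)]
      simp
  rw [h2, h2]
  exact (hu.contDiffAt.isSymmSndFDerivAt (n := ∞) (by simpa using ENat.LEInfty.out)).eq w v

/-- Two integrations by parts and the symmetry of mixed partials show that ∫ u_x conj(u_y) equals
its own conjugate. -/
theorem integral_im_fderiv_mul_conj_fderiv {u : ℂ → ℂ} (hu : ContDiff ℝ ∞ u)
    (hc : HasCompactSupport u) :
    ∫ z, (fderiv ℝ u z 1 * conj (fderiv ℝ u z Complex.I)).im = 0 := by
  have hd : Differentiable ℝ u := hu.differentiable (by simp)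
  have hcc : HasCompactSupport fun z => conj (u z) := hc.comp_left (g := conj) (map_zero _)
  have key : ∀ v w : ℂ, ∫ z, fderiv ℝ u z v * conj (fderiv ℝ u z w) =
      -∫ z, fderiv ℝ (fun z => fderiv ℝ u z v) z w * conj (u z) := fun v w => by
    rw [← integral_mul_fderiv_of_hasCompactSupport (contDiff_fderiv_apply hu v)
      (contDiff_conj_comp hu) hcc w]
    simp_rw [fderiv_conj_comp hd]
  have h1 : ∫ z, fderiv ℝ u z 1 * conj (fderiv ℝ u z Complex.I) =
      conj (∫ z, fderiv ℝ u z 1 * conj (fderiv ℝ u z Complex.I)) := by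
    rw [← integral_conj]
    simp_rw [map_mul, Complex.conj_conj, mul_comm (conj (fderiv ℝ u _ 1))]
    rw [key, key]
    simp_rw [fderiv_fderiv_apply_comm hu 1 Complex.I]
  have hint : Integrable fun z => fderiv ℝ u z 1 * conj (fderiv ℝ u z Complex.I) := by
    refine Continuous.integrable_of_hasCompactSupport ?_
      (hc.fderiv_apply (𝕜 := ℝ) 1).mul_right
    exact (contDiff_fderiv_apply hu 1).continuous.mul
      (contDiff_conj_comp (contDiff_fderiv_apply hu Complex.I)).continuous
  have h2 := integral_im hint
  simp only [RCLike.im_to_complex] at h2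
  rw [h2]
  exact Complex.conj_eq_iff_im.1 h1.symm

/-- Integration by parts for the radial weights `x ∂x |u|²` and `y ∂y |u|²`. -/
theorem integral_clm_mul_re_fderiv {u : ℂ → ℂ} (hu : ContDiff ℝ ∞ u) (hc : HasCompactSupport u)
    (ℓ : ℂ →L[ℝ] ℝ) (v : ℂ) (hv : ℓ v = 1) :
    ∫ z, ℓ z * (fderiv ℝ u z v * conj (u z)).re = -(1 / 2) * ∫ z, ‖u z‖ ^ 2 := by
  have hd : Differentiable ℝ u := hu.differentiable (by simp)
  have hw : ContDiff ℝ ∞ fun z => ‖u z‖ ^ 2 := hu.norm_sq ℂ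
  have hwc : HasCompactSupport fun z => ‖u z‖ ^ 2 :=
    hc.comp_left (g := fun z => ‖z‖ ^ 2) (by simp)
  have e : ∀ z, fderiv ℝ (fun z => ‖u z‖ ^ 2) z v = 2 * (fderiv ℝ u z v * conj (u z)).re :=
    fun z => by
      have := ((hd z).hasFDerivAt.norm_sq).fderiv
      rw [this]
      simp [Complex.inner]
      ring
  have hf' : Continuous fun z => fderiv ℝ (fun z => ‖u z‖ ^ 2) z v :=
    (hw.continuous_fderiv (by simp)).clm_apply continuous_const
  have h := integral_mul_fderiv_eq_neg_fderiv_mul_of_integrable (μ := (volume : Measure ℂ))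
    (f := ℓ) (g := fun z => ‖u z‖ ^ 2) (v := v) ?_ ?_ ?_
    (fun z _ => ℓ.differentiableAt) (fun z _ => hw.differentiable (by simp) z)
  · simp_rw [e, ContinuousLinearMap.fderiv, hv, one_mul] at h
    have : ∀ z, ℓ z * (2 * (fderiv ℝ u z v * conj (u z)).re) =
      2 * (ℓ z * (fderiv ℝ u z v * conj (u z)).re) := fun z => by ring
    simp_rw [this] at h
    rw [integral_const_mul] at h
    linarith
  · simp_rw [ContinuousLinearMap.fderiv]
    exact (continuous_const.mul hw.continuous).integrable_of_hasCompactSupport hwc.mul_left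
  · exact (ℓ.continuous.mul hf').integrable_of_hasCompactSupport
      (hwc.fderiv_apply (𝕜 := ℝ) v).mul_left
  · exact (ℓ.continuous.mul hw.continuous).integrable_of_hasCompactSupport hwc.mul_left

theorem continuous_classicalZ (σ : ℝ) {u : ℂ → ℂ} (hu : ContDiff ℝ ∞ u) :
    Continuous (classicalZ σ u) := by
  have h1 := continuous_weylDeriv 1 hu
  have h2 := continuous_weylDeriv Complex.I hu
  unfold classicalZ
  fun_prop

theorem hasCompactSupport_classicalZ (σ : ℝ) {u : ℂ → ℂ} (hc : HasCompactSupport u) :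
    HasCompactSupport (classicalZ σ u) := by
  have h1 := hasCompactSupport_weylDeriv 1 hc
  have h2 : HasCompactSupport fun z => Complex.I * σ * weylDeriv Complex.I u z :=
    (hasCompactSupport_weylDeriv Complex.I hc).mul_left
  exact (h1.sub h2).comp_left (g := fun z => z / 2) (by simp)

/-- On smooth compactly supported functions the adjoint of Z is -Z̄ and [Z̄, Z] = 1. Concretely,
expanding the squares leaves three terms: Im(u_x conj(u_y)) integrates to zero, and the weighted
terms x Re(u_x ū) and y Re(u_y ū) contribute -½‖u‖² each. -/
theorem integral_norm_classicalZ_neg (σ : ℝ) {u : ℂ → ℂ} (hu : ContDiff ℝ ∞ u)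
    (hc : HasCompactSupport u) :
    ∫ z, ‖classicalZ (-σ) u z‖ ^ 2 = (∫ z, ‖classicalZ σ u z‖ ^ 2) + σ * ∫ z, ‖u z‖ ^ 2 := by
  have hpt : ∀ z, ‖classicalZ (-σ) u z‖ ^ 2 = ‖classicalZ σ u z‖ ^ 2 +
      σ * ((fderiv ℝ u z 1 * conj (fderiv ℝ u z Complex.I)).im -
        Complex.reCLM z * (fderiv ℝ u z 1 * conj (u z)).re -
        Complex.imCLM z * (fderiv ℝ u z Complex.I * conj (u z)).re) := fun z => by
    rw [← Complex.normSq_eq_norm_sq, ← Complex.normSq_eq_norm_sq, Complex.normSq_apply,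
      Complex.normSq_apply]
    simp [classicalZ, weylDeriv]
    ring
  have hint : ∀ f : ℂ → ℝ, Continuous f → HasCompactSupport f → Integrable f := fun f h1 h2 =>
    h1.integrable_of_hasCompactSupport h2
  have hp := fun v => (contDiff_fderiv_apply hu v).continuous
  have hp' := fun v => (contDiff_conj_comp (contDiff_fderiv_apply hu v)).continuous
  have hu' := (contDiff_conj_comp hu).continuous
  have i1 : Integrable fun z => (fderiv ℝ u z 1 * conj (fderiv ℝ u z Complex.I)).im := by
    refine hint _ (Complex.continuous_im.comp ((hp 1).mul (hp' _))) ?_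
    exact ((hc.fderiv_apply (𝕜 := ℝ) 1).mul_right).comp_left (g := Complex.im) rfl
  have i2 : ∀ (ℓ : ℂ →L[ℝ] ℝ) (v : ℂ),
      Integrable fun z => ℓ z * (fderiv ℝ u z v * conj (u z)).re := fun ℓ v => by
    refine hint _ (ℓ.continuous.mul (Complex.continuous_re.comp ((hp v).mul hu'))) ?_
    exact (((hc.fderiv_apply (𝕜 := ℝ) v).mul_right).comp_left (g := Complex.re) rfl).mul_left
  have i3 : Integrable fun z => ‖classicalZ σ u z‖ ^ 2 := by
    refine hint _ ((continuous_classicalZ σ hu).norm.pow 2) ?_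
    exact (hasCompactSupport_classicalZ σ hc).comp_left (g := fun z => ‖z‖ ^ 2) (by simp)
  have i4 := i1.sub (i2 Complex.reCLM 1)
  have i5 := i4.sub (i2 Complex.imCLM Complex.I)
  rw [integral_congr_ae (Eventually.of_forall hpt)]
  simp only [Pi.sub_def] at i4 i5
  rw [integral_add i3 (i5.const_mul σ), integral_const_mul,
    integral_sub i4 (i2 _ _), integral_sub i1 (i2 _ _),
    integral_im_fderiv_mul_conj_fderiv hu hc, integral_clm_mul_re_fderiv hu hc _ _ (by simp),
    integral_clm_mul_re_fderiv hu hc _ _ (by simp)]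
  ring

theorem eLpNorm_classicalZ_neg_le {σ : ℝ} (hσ : σ ^ 2 = 1) {u : ℂ → ℂ} (hu : ContDiff ℝ ∞ u)
    (hc : HasCompactSupport u) :
    eLpNorm (classicalZ (-σ) u) 2 volume ≤
      eLpNorm (classicalZ σ u) 2 volume + eLpNorm u 2 volume := by
  have e : ∀ f : ℂ → ℂ, Continuous f → HasCompactSupport f →
      eLpNorm f 2 volume ^ 2 = ENNReal.ofReal (∫ z, ‖f z‖ ^ 2) := fun f h1 h2 => by
    rw [eLpNorm_two_sq, ofReal_integral_eq_lintegral_ofReal]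
    · simp_rw [ENNReal.ofReal_pow (norm_nonneg _), ofReal_norm]
    · have h3 : HasCompactSupport fun z => ‖f z‖ ^ 2 :=
        h2.comp_left (g := fun z : ℂ => ‖z‖ ^ 2) (by simp)
      exact Continuous.integrable_of_hasCompactSupport (h1.norm.pow 2) h3
    · exact Eventually.of_forall fun z => by positivity
  rw [← ENNReal.pow_le_pow_left_iff two_ne_zero]
  refine le_trans ?_ (?_ : eLpNorm (classicalZ σ u) 2 volume ^ 2 + eLpNorm u 2 volume ^ 2 ≤ _)
  · rw [e _ (continuous_classicalZ _ hu) (hasCompactSupport_classicalZ _ hc),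
      e _ (continuous_classicalZ _ hu) (hasCompactSupport_classicalZ _ hc),
      e _ hu.continuous hc, ← ENNReal.ofReal_add (by positivity) (by positivity)]
    refine ENNReal.ofReal_le_ofReal ?_
    rw [integral_norm_classicalZ_neg σ hu hc]
    have h0 : 0 ≤ ∫ z, ‖u z‖ ^ 2 := by positivity
    have h1 : σ ≤ 1 := by nlinarith
    linarith [mul_le_mul_of_nonneg_right h1 h0]
  · rw [add_sq]
    calc _ ≤ eLpNorm (classicalZ σ u) 2 volume ^ 2 + eLpNorm u 2 volume ^ 2 +
          2 * eLpNorm (classicalZ σ u) 2 volume * eLpNorm u 2 volume := le_self_add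
      _ = _ := by ring

/-- The a priori estimate behind the equivalence of Z and Z̄: only one of the two operators appears
on the right, the other having been traded for ‖u‖ by the commutation identity. -/
theorem eLpNorm_weylFun_sub_le_classicalZ {σ : ℝ} (hσ : σ ^ 2 = 1) (v : ℂ) {u : ℂ → ℂ}
    (hu : ContDiff ℝ ∞ u) (hc : HasCompactSupport u) :
    eLpNorm (fun z => weylFun v u z - u z) 2 volume ≤
      ‖v‖ₑ * (2 * eLpNorm (classicalZ σ u) 2 volume + eLpNorm u 2 volume) := by
  have hm : ∀ τ, AEStronglyMeasurable (fun z => ‖classicalZ τ u z‖) (volume : Measure ℂ) :=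
    fun τ => (continuous_classicalZ τ hu).norm.aestronglyMeasurable
  refine (eLpNorm_weylFun_sub_le v hu).trans ?_
  have h1 : eLpNorm (weylDeriv v u) 2 volume ≤
      eLpNorm (fun z => ‖v‖ * (‖classicalZ σ u z‖ + ‖classicalZ (-σ) u z‖)) 2 volume :=
    eLpNorm_mono_real fun z => norm_weylDeriv_le hσ v u z
  have h2 : eLpNorm (fun z => ‖v‖ * (‖classicalZ σ u z‖ + ‖classicalZ (-σ) u z‖)) 2 volume =
      ‖v‖ₑ * eLpNorm (fun z => ‖classicalZ σ u z‖ + ‖classicalZ (-σ) u z‖) 2 volume := by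
    rw [← enorm_norm v]
    exact eLpNorm_const_smul ‖v‖ (fun z => ‖classicalZ σ u z‖ + ‖classicalZ (-σ) u z‖) 2 volume
  have h3 : eLpNorm (fun z => ‖classicalZ σ u z‖ + ‖classicalZ (-σ) u z‖) 2 volume ≤
      eLpNorm (classicalZ σ u) 2 volume + eLpNorm (classicalZ (-σ) u) 2 volume := by
    have := eLpNorm_add_le (hm σ) (hm (-σ)) (p := 2) (by norm_num)
    rwa [eLpNorm_norm, eLpNorm_norm] at this
  refine h1.trans (h2.trans_le ?_)
  gcongr
  refine h3.trans ?_
  rw [two_mul, add_assoc]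
  gcongr
  exact eLpNorm_classicalZ_neg_le hσ hu hc

/-! ### Mollification and cutoff -/

/-- Young's inequality for averages of translates. -/
theorem eLpNorm_le_of_enorm_le_lintegral (φ : ContDiffBump (0 : ℂ)) {f F : ℂ → ℂ}
    (hf : AEStronglyMeasurable f volume)
    (hF : ∀ z, ‖F z‖ₑ ≤ ∫⁻ t, ENNReal.ofReal (φ.normed volume t) * ‖f (z - t)‖ₑ) :
    eLpNorm F 2 volume ≤ eLpNorm f 2 volume := by
  let ρ : ℂ → ENNReal := fun t => ENNReal.ofReal (φ.normed volume t)
  have hρ : Measurable ρ :=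
    ENNReal.measurable_ofReal.comp (φ.contDiff_normed (n := 0)).continuous.measurable
  let μ : Measure ℂ := volume.withDensity ρ
  have hμ : IsProbabilityMeasure μ := ⟨by
    rw [withDensity_apply _ MeasurableSet.univ, Measure.restrict_univ,
      ← ofReal_integral_eq_lintegral_ofReal φ.integrable_normed
        (Eventually.of_forall fun t => φ.nonneg_normed t), φ.integral_normed, ENNReal.ofReal_one]⟩
  have hac : μ ≪ volume := withDensity_absolutelyContinuous _ _
  have hm : AEMeasurable (fun p : ℂ × ℂ => ‖f (p.1 - p.2)‖ₑ) (volume.prod volume) :=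
    (hf.comp_quasiMeasurePreserving
      (quasiMeasurePreserving_sub_of_right_invariant volume volume)).enorm
  have hm' : AEMeasurable (Function.uncurry fun z t => ‖f (z - t)‖ₑ)
      ((volume : Measure ℂ).prod μ) :=
    hm.mono_ac (Measure.AbsolutelyContinuous.rfl.prod hac)
  rw [← ENNReal.pow_le_pow_left_iff two_ne_zero, eLpNorm_two_sq, eLpNorm_two_sq]
  refine le_trans (lintegral_mono fun z => ?_)
    (lintegral_lintegral_sq_le (μ := μ) hm' fun t =>
      (lintegral_sub_right_eq_self (fun z => ‖f z‖ₑ ^ 2) t).le)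
  gcongr
  refine (hF z).trans_eq ?_
  rw [lintegral_withDensity_eq_lintegral_mul₀ hρ.aemeasurable]
  · rfl
  · exact (hf.comp_quasiMeasurePreserving
      (quasiMeasurePreserving_sub_left_of_right_invariant volume z)).enorm

/-- The mollification of `g` by a normalised bump. -/
def mollify (φ : ContDiffBump (0 : ℂ)) (g : ℂ → ℂ) : ℂ → ℂ :=
  convolution (φ.normed volume) g (ContinuousLinearMap.lsmul ℝ ℝ) volume

theorem mollify_apply (φ : ContDiffBump (0 : ℂ)) (g : ℂ → ℂ) (z : ℂ) :
    mollify φ g z = ∫ t, (φ.normed volume t : ℂ) * g (z - t) := by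
  simp [mollify, convolution_def, Complex.real_smul]

theorem mollify_apply_swap (φ : ContDiffBump (0 : ℂ)) (g : ℂ → ℂ) (z : ℂ) :
    mollify φ g z = ∫ w, g w * (φ.normed volume (z - w) : ℂ) := by
  simp [mollify, convolution_eq_swap, Complex.real_smul, mul_comm]

theorem contDiff_mollify (φ : ContDiffBump (0 : ℂ)) {g : ℂ → ℂ} (hg : LocallyIntegrable g) :
    ContDiff ℝ ∞ (mollify φ g) :=
  φ.hasCompactSupport_normed.contDiff_convolution_left _ φ.contDiff_normed hg

theorem eLpNorm_mollify_le (φ : ContDiffBump (0 : ℂ)) {g : ℂ → ℂ}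
    (hg : AEStronglyMeasurable g volume) :
    eLpNorm (mollify φ g) 2 volume ≤ eLpNorm g 2 volume := by
  refine eLpNorm_le_of_enorm_le_lintegral φ hg fun z => ?_
  rw [mollify_apply]
  refine (enorm_integral_le_lintegral_enorm _).trans_eq (lintegral_congr fun t => ?_)
  rw [enorm_mul, ← ofReal_norm, Complex.norm_real, Real.norm_of_nonneg (φ.nonneg_normed t)]

theorem fderiv_mollify (φ : ContDiffBump (0 : ℂ)) {g : ℂ → ℂ} (hg : LocallyIntegrable g)
    (z v : ℂ) :
    fderiv ℝ (mollify φ g) z v =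
      ∫ w, g w * ((fderiv ℝ (φ.normed volume) (z - w) v : ℝ) : ℂ) := by
  have hcs := φ.hasCompactSupport_normed (μ := (volume : Measure ℂ))
  have h1 := (hcs.hasFDerivAt_convolution_left
    (ContinuousLinearMap.lsmul ℝ ℝ : ℝ →L[ℝ] ℂ →L[ℝ] ℂ) φ.contDiff_normed hg z).fderiv
  have h2 := (hcs.fderiv ℝ).convolutionExists_left
    ((ContinuousLinearMap.lsmul ℝ ℝ : ℝ →L[ℝ] ℂ →L[ℝ] ℂ).precompL ℂ)
    ((φ.contDiff_normed (μ := volume) (n := 1)).continuous_fderiv (by simp)) hg z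
  rw [mollify, h1, convolution_def, ContinuousLinearMap.integral_apply h2,
    ← integral_sub_left_eq_self _ volume z]
  simp [Complex.real_smul, mul_comm]

theorem classicalZ_apply (σ : ℝ) (u : ℂ → ℂ) (z : ℂ) :
    classicalZ σ u z = (fderiv ℝ u z 1 - Complex.I * σ * fderiv ℝ u z Complex.I) / 2 +
      (σ * z.re - Complex.I * z.im) / 2 * u z := by
  simp only [classicalZ, weylDeriv, mul_one, Complex.conj_im, Complex.mul_im, Complex.conj_re,
    Complex.I_re, Complex.I_im, mul_zero, add_zero]
  push_cast
  linear_combination (-(σ : ℂ) * z.re / 2 * u z) * Complex.I_sq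

/-- Mollification commutes with derivatives but not with the zeroth-order coefficient. That
coefficient is additive in z, so splitting z = (z - t) + t leaves an error in which the bump is
weighted by the coefficient at t. -/
theorem classicalZ_mollify {σ : ℝ} {g h : L2C} (H : IsWeakZ σ g h) (φ : ContDiffBump (0 : ℂ))
    (z : ℂ) :
    classicalZ σ (mollify φ g) z = mollify φ h z +
      ∫ t, (σ * t.re - Complex.I * t.im) / 2 * (φ.normed volume t : ℂ) * g (z - t) := by
  have hgl : LocallyIntegrable g := (Lp.memLp g).locallyIntegrable (by norm_num)
  let ψ : ℂ → ℂ := fun w => (φ.normed volume (z - w) : ℂ)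
  have hρ : ContDiff ℝ ∞ (φ.normed (volume : Measure ℂ)) := φ.contDiff_normed
  have hψ : ContDiff ℝ ∞ ψ :=
    Complex.ofRealCLM.contDiff.comp (hρ.comp (contDiff_const.sub contDiff_id))
  have hcρ : HasCompactSupport fun w : ℂ => φ.normed volume (z - w) :=
    φ.hasCompactSupport_normed.comp_homeomorph (Homeomorph.subLeft z)
  have hcψ : HasCompactSupport ψ := hcρ.comp_left (g := fun x : ℝ => (x : ℂ)) rfl
  have hdψ : ∀ w v, fderiv ℝ ψ w v = -((fderiv ℝ (φ.normed volume) (z - w) v : ℝ) : ℂ) :=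
    fun w v => by
      have h1 : HasFDerivAt (fun w : ℂ => z - w) (-ContinuousLinearMap.id ℝ ℂ) w :=
        (hasFDerivAt_id w).const_sub z
      have h2 := Complex.ofRealCLM.hasFDerivAt.comp w
        ((hρ.differentiable (by simp) (z - w)).hasFDerivAt.comp w h1)
      have h3 : HasFDerivAt ψ _ w := h2
      rw [h3.fderiv]
      simp
  have hI : ∀ v, Integrable fun w => g w * fderiv ℝ ψ w v := fun v =>
    integrable_lp_mul g ((contDiff_fderiv_apply hψ v).continuous.memLp_of_hasCompactSupport
      (hcψ.fderiv_apply (𝕜 := ℝ) v))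
  have hI' : ∀ k : ℂ → ℂ, Continuous k → Integrable fun w => g w * (k w * ψ w) := fun k hk =>
    integrable_lp_mul g ((hk.mul hψ.continuous).memLp_of_hasCompactSupport hcψ.mul_left)
  have hd : ∀ v, fderiv ℝ (mollify φ g) z v = -∫ w, g w * fderiv ℝ ψ w v := fun v => by
    rw [fderiv_mollify φ hgl, ← integral_neg]
    refine integral_congr_ae (Eventually.of_forall fun w => ?_)
    simp [hdψ]
  have e1 : ∫ t, (σ * t.re - Complex.I * t.im) / 2 * (φ.normed volume t : ℂ) * g (z - t) =
      ∫ w, g w * ((σ * (z - w).re - Complex.I * (z - w).im) / 2 * ψ w) := by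
    rw [← integral_sub_left_eq_self _ volume z]
    refine integral_congr_ae (Eventually.of_forall fun w => ?_)
    simp only [ψ, sub_sub_cancel]
    ring
  have e2 : mollify φ h z = ∫ w, h w * ψ w := mollify_apply_swap φ h z
  have e3 : mollify φ g z = ∫ w, g w * (1 * ψ w) := by simp [mollify_apply_swap, ψ]
  rw [classicalZ_apply, hd, hd, e1, e2, e3, ← H ψ hψ hcψ]
  have c1 : Continuous fun w : ℂ => (σ * w.re - Complex.I * w.im : ℂ) / 2 := by fun_prop
  have c2 : Continuous fun w : ℂ => (σ * (z - w).re - Complex.I * (z - w).im : ℂ) / 2 := by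
    fun_prop
  have s1 : ∫ w, g w * (-((fderiv ℝ ψ w 1 - Complex.I * σ * fderiv ℝ ψ w Complex.I) / 2) +
      (σ * w.re - Complex.I * w.im) / 2 * ψ w) =
      -(1 / 2) * (∫ w, g w * fderiv ℝ ψ w 1) +
        Complex.I * σ / 2 * (∫ w, g w * fderiv ℝ ψ w Complex.I) +
        ∫ w, g w * ((σ * w.re - Complex.I * w.im) / 2 * ψ w) := by
    have hadd := ((hI 1).const_mul (-(1 / 2))).add ((hI Complex.I).const_mul (Complex.I * σ / 2))
    simp only [Pi.add_def] at hadd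
    rw [← integral_const_mul, ← integral_const_mul, ← integral_add ((hI _).const_mul _)
      ((hI _).const_mul _), ← integral_add hadd (hI' _ c1)]
    refine integral_congr_ae (Eventually.of_forall fun w => ?_)
    ring
  have s2 : (σ * z.re - Complex.I * z.im) / 2 * ∫ w, g w * (1 * ψ w) =
      (∫ w, g w * ((σ * w.re - Complex.I * w.im) / 2 * ψ w)) +
      ∫ w, g w * ((σ * (z - w).re - Complex.I * (z - w).im) / 2 * ψ w) := by
    rw [← integral_const_mul, ← integral_add (hI' _ c1) (hI' _ c2)]
    refine integral_congr_ae (Eventually.of_forall fun w => ?_)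
    simp only [Complex.sub_re, Complex.sub_im]
    push_cast
    ring
  rw [s1, s2]
  ring

/-- On the support of the bump ‖t‖ ≤ 1, so the weight in the commutator error is at most 1/2 and
Young's inequality bounds the error by the norm of g, uniformly in the bump. -/
theorem eLpNorm_classicalZ_mollify_le {σ : ℝ} (hσ : σ ^ 2 = 1) {g h : L2C} (H : IsWeakZ σ g h)
    (φ : ContDiffBump (0 : ℂ)) (hφ : φ.rOut ≤ 1) :
    eLpNorm (classicalZ σ (mollify φ g)) 2 volume ≤ ‖h‖ₑ + ‖g‖ₑ := by
  have hgl : LocallyIntegrable g := (Lp.memLp g).locallyIntegrable (by norm_num)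
  have hhl : LocallyIntegrable h := (Lp.memLp h).locallyIntegrable (by norm_num)
  let E : ℂ → ℂ := fun z =>
    ∫ t, (σ * t.re - Complex.I * t.im) / 2 * (φ.normed volume t : ℂ) * g (z - t)
  have e : classicalZ σ (mollify φ g) = mollify φ h + E := funext (classicalZ_mollify H φ)
  have hm1 : AEStronglyMeasurable (mollify φ h) volume :=
    (contDiff_mollify φ hhl).continuous.aestronglyMeasurable
  have hm2 : AEStronglyMeasurable E volume := by
    have : E = classicalZ σ (mollify φ g) - mollify φ h := by rw [e, add_sub_cancel_left]
    rw [this]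
    exact (continuous_classicalZ σ (contDiff_mollify φ hgl)).aestronglyMeasurable.sub hm1
  have hE : eLpNorm E 2 volume ≤ eLpNorm g 2 volume := by
    refine eLpNorm_le_of_enorm_le_lintegral φ (Lp.aestronglyMeasurable g) fun z => ?_
    refine (enorm_integral_le_lintegral_enorm _).trans (lintegral_mono fun t => ?_)
    rw [enorm_mul]
    gcongr
    rw [← ofReal_norm]
    refine ENNReal.ofReal_le_ofReal ?_
    rw [norm_mul, Complex.norm_real, Real.norm_of_nonneg (φ.nonneg_normed t)]
    by_cases ht : ‖t‖ ≤ 1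
    · refine mul_le_of_le_one_left (φ.nonneg_normed t) ?_
      have h1 : ‖(σ * t.re - Complex.I * t.im : ℂ)‖ = ‖t‖ := by
        have : (σ * t.re - Complex.I * t.im : ℂ) = ⟨σ * t.re, -t.im⟩ := by
          apply Complex.ext <;> simp
        rw [this, Complex.norm_def, Complex.norm_def, Complex.normSq_mk, Complex.normSq_apply]
        congr 1
        linear_combination t.re ^ 2 * hσ
      rw [norm_div, h1]
      norm_num
      linarith
    · have : φ.normed volume t = 0 := by
        by_contra hne
        have : t ∈ Function.support (φ.normed (volume : Measure ℂ)) := hne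
        rw [φ.support_normed_eq, mem_ball_zero_iff] at this
        linarith
      rw [this, mul_zero]
  rw [e]
  refine (eLpNorm_add_le hm1 hm2 (by norm_num)).trans ?_
  rw [Lp.enorm_def, Lp.enorm_def]
  exact add_le_add (eLpNorm_mollify_le φ (Lp.aestronglyMeasurable h)) hE

/-- Smooth cutoffs with uniformly bounded derivative that are eventually one. -/
theorem exists_cutoff : ∃ (χ : ℕ → ℂ → ℝ) (C : ℝ), 0 ≤ C ∧ (∀ n, ContDiff ℝ ∞ (χ n)) ∧
    (∀ n, HasCompactSupport (χ n)) ∧ (∀ n z, |χ n z| ≤ 1) ∧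
    (∀ n z v, |fderiv ℝ (χ n) z v| ≤ C * ‖v‖) ∧ ∀ z, ∀ᶠ n in atTop, χ n z = 1 := by
  let b : ContDiffBump (0 : ℂ) := ⟨1, 2, one_pos, one_lt_two⟩
  have hb : ContDiff ℝ ∞ b := b.contDiff
  obtain ⟨C, hC⟩ := (hb.continuous_fderiv (by simp)).bounded_above_of_compact_support
    (b.hasCompactSupport.fderiv ℝ)
  have hC0 : 0 ≤ C := (norm_nonneg _).trans (hC 0)
  have hn : ∀ n : ℕ, (0 : ℝ) < ((n : ℝ) + 1)⁻¹ := fun n => by positivity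
  have hn1 : ∀ n : ℕ, ((n : ℝ) + 1)⁻¹ ≤ 1 := fun n => inv_le_one_of_one_le₀ (by linarith [n.cast_nonneg (α := ℝ)])
  refine ⟨fun n z => b ((((n : ℝ) + 1)⁻¹) • z), C, hC0, fun n => hb.comp (contDiff_const_smul _),
    fun n => b.hasCompactSupport.comp_smul (hn n).ne', fun n z => ?_, fun n z v => ?_, fun z => ?_⟩
  · rw [abs_of_nonneg b.nonneg]
    exact b.le_one
  · have h1 : HasFDerivAt (fun z : ℂ => (((n : ℝ) + 1)⁻¹) • z)
        ((((n : ℝ) + 1)⁻¹) • ContinuousLinearMap.id ℝ ℂ) z :=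
      HasFDerivAt.fun_const_smul (hasFDerivAt_id z) _
    have h2 := ((hb.differentiable (by simp) ((((n : ℝ) + 1)⁻¹) • z)).hasFDerivAt.comp z h1).fderiv
    have h3 : fderiv ℝ (fun z => b ((((n : ℝ) + 1)⁻¹) • z)) z v =
        ((n : ℝ) + 1)⁻¹ * fderiv ℝ b ((((n : ℝ) + 1)⁻¹) • z) v := by
      have : (fun z => b ((((n : ℝ) + 1)⁻¹) • z)) = b ∘ fun z : ℂ => (((n : ℝ) + 1)⁻¹) • z := rfl
      rw [this, h2]
      simp only [ContinuousLinearMap.comp_apply, smul_apply,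
        ContinuousLinearMap.id_apply, map_smul, smul_eq_mul]
    rw [h3, abs_mul, abs_of_pos (hn n)]
    refine (mul_le_of_le_one_left (abs_nonneg _) (hn1 n)).trans ?_
    exact ((fderiv ℝ b _).le_opNorm v).trans (by gcongr; exact hC _)
  · obtain ⟨N, hN⟩ := exists_nat_ge ‖z‖
    filter_upwards [eventually_ge_atTop N] with n hnN
    refine b.one_of_mem_closedBall ?_
    rw [mem_closedBall_zero_iff, norm_smul, Real.norm_of_nonneg (hn n).le]
    have h1 : ‖z‖ ≤ (n : ℝ) + 1 := by
      have : (N : ℝ) ≤ n := by exact_mod_cast hnN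
      linarith
    exact (inv_mul_le_iff₀ (by positivity)).2 (by simpa [b] using h1)

theorem classicalZ_ofReal_mul (σ : ℝ) {χ : ℂ → ℝ} {u : ℂ → ℂ} (hχ : Differentiable ℝ χ)
    (hu : Differentiable ℝ u) (z : ℂ) :
    classicalZ σ (fun z => (χ z : ℂ) * u z) z = χ z * classicalZ σ u z +
      (fderiv ℝ χ z 1 - Complex.I * σ * fderiv ℝ χ z Complex.I) / 2 * u z := by
  have h1 : HasFDerivAt (fun z => (χ z : ℂ)) (Complex.ofRealCLM.comp (fderiv ℝ χ z)) z :=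
    Complex.ofRealCLM.hasFDerivAt.comp z (hχ z).hasFDerivAt
  have h2 := (h1.mul (hu z).hasFDerivAt).fderiv
  have h3 : ∀ v, fderiv ℝ (fun z => (χ z : ℂ) * u z) z v =
      χ z * fderiv ℝ u z v + fderiv ℝ χ z v * u z := fun v => by
    have : (fun z => (χ z : ℂ) * u z) = (fun z => (χ z : ℂ)) * u := rfl
    rw [this, h2]
    simp [mul_comm]
  simp only [classicalZ_apply, h3]
  ring

/-! ### From weak derivatives to the Lipschitz condition -/

/-- Mollified cutoffs u_n of g are test functions converging to g almost everywhere, with u_n and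
Z_σ u_n bounded in L². The a priori estimate holds for each u_n with one constant and survives the
limit. -/
theorem IsWeakZ.weylLip {σ : ℝ} (hσ : σ ^ 2 = 1) {g h : L2C} (H : IsWeakZ σ g h) :
    WeylLip g := by
  have hgl : LocallyIntegrable g := (Lp.memLp g).locallyIntegrable (by norm_num)
  obtain ⟨χ, C, hC0, hχ, hχc, hχ1, hχd, hχt⟩ := exists_cutoff
  have hpos : ∀ n : ℕ, (0 : ℝ) < 1 / ((n : ℝ) + 1) := fun n => Nat.one_div_pos_of_nat
  -- The inner radius is half the outer one: almost everywhere convergence of the mollifications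
  -- needs a bounded ratio of radii.
  let φ : ℕ → ContDiffBump (0 : ℂ) := fun n =>
    ⟨1 / ((n : ℝ) + 1) / 2, 1 / ((n : ℝ) + 1), half_pos (hpos n), half_lt_self (hpos n)⟩
  have hφ1 : ∀ n, (φ n).rOut ≤ 1 := fun n => by
    simpa [φ] using Nat.one_div_le_one_div (α := ℝ) (Nat.zero_le n)
  let u : ℕ → ℂ → ℂ := fun n z => (χ n z : ℂ) * mollify (φ n) g z
  have hsm : ∀ n, ContDiff ℝ ∞ (mollify (φ n) g) := fun n => contDiff_mollify _ hgl
  have hu : ∀ n, ContDiff ℝ ∞ (u n) := fun n =>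
    (Complex.ofRealCLM.contDiff.comp (hχ n)).mul (hsm n)
  have huc : ∀ n, HasCompactSupport (u n) := fun n =>
    HasCompactSupport.mul_right ((hχc n).comp_left (g := fun x : ℝ => (x : ℂ)) rfl)
  have hlim : ∀ᵐ z, Tendsto (fun n => u n z) atTop (𝓝 (g z)) := by
    have h1 : Tendsto (fun n => (φ n).rOut) atTop (𝓝 0) :=
      tendsto_one_div_add_atTop_nhds_zero_nat
    have h2 : ∀ᶠ n in atTop, (φ n).rOut ≤ 2 * (φ n).rIn :=
      Eventually.of_forall fun n => by simp only [φ]; linarith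
    filter_upwards [ContDiffBump.ae_convolution_tendsto_right_of_locallyIntegrable h1 h2 hgl]
      with z hz
    refine (Tendsto.congr' ?_ hz)
    filter_upwards [hχt z] with n hn
    simp [u, hn, mollify]
  have hM : ∀ n, eLpNorm (mollify (φ n) g) 2 volume ≤ ‖g‖ₑ := fun n => by
    rw [Lp.enorm_def]
    exact eLpNorm_mollify_le _ (Lp.aestronglyMeasurable g)
  have hu2 : ∀ n, eLpNorm (u n) 2 volume ≤ ‖g‖ₑ := fun n => by
    refine (eLpNorm_mono fun z => ?_).trans (hM n)
    rw [norm_mul, Complex.norm_real]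
    exact mul_le_of_le_one_left (norm_nonneg _) (hχ1 n z)
  have hZ : ∀ n, eLpNorm (classicalZ σ (u n)) 2 volume ≤
      (‖h‖ₑ + ‖g‖ₑ) + ENNReal.ofReal C * ‖g‖ₑ := fun n => by
    have e : classicalZ σ (u n) = (fun z => (χ n z : ℂ) * classicalZ σ (mollify (φ n) g) z) +
        fun z => (fderiv ℝ (χ n) z 1 - Complex.I * σ * fderiv ℝ (χ n) z Complex.I) / 2 *
          mollify (φ n) g z :=
      funext fun z => classicalZ_ofReal_mul σ ((hχ n).differentiable (by simp))
        ((hsm n).differentiable (by simp)) z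
    have cχ := (hχ n).continuous
    have cm := (hsm n).continuous
    have cz := continuous_classicalZ σ (hsm n)
    have cd : ∀ v, Continuous fun z => fderiv ℝ (χ n) z v := fun v =>
      ((hχ n).continuous_fderiv (by simp)).clm_apply continuous_const
    have cd1 := cd 1
    have cd2 := cd Complex.I
    rw [e]
    refine (eLpNorm_add_le (Continuous.aestronglyMeasurable (by fun_prop))
      (Continuous.aestronglyMeasurable (by fun_prop)) (by norm_num)).trans (add_le_add ?_ ?_)
    · refine (eLpNorm_mono fun z => ?_).trans (eLpNorm_classicalZ_mollify_le hσ H (φ n) (hφ1 n))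
      rw [norm_mul, Complex.norm_real]
      exact mul_le_of_le_one_left (norm_nonneg _) (hχ1 n z)
    · refine (eLpNorm_le_mul_eLpNorm_of_ae_le_mul (g := mollify (φ n) g) (c := C)
        (Eventually.of_forall fun z => ?_) 2).trans (by gcongr; exact hM n)
      rw [norm_mul]
      gcongr
      have hσ1 : |σ| = 1 := by
        rw [← sq_abs] at hσ
        nlinarith [abs_nonneg σ]
      have a1 := hχd n z 1
      have a2 := hχd n z Complex.I
      rw [norm_one] at a1
      rw [Complex.norm_I] at a2
      rw [norm_div, Complex.norm_ofNat, div_le_iff₀ two_pos]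
      refine (norm_sub_le _ _).trans ?_
      rw [norm_mul, norm_mul, Complex.norm_I, Complex.norm_real, Complex.norm_real,
        Complex.norm_real, Real.norm_eq_abs, Real.norm_eq_abs, Real.norm_eq_abs, hσ1]
      linarith
  let K : ENNReal := 2 * ((‖h‖ₑ + ‖g‖ₑ) + ENNReal.ofReal C * ‖g‖ₑ) + ‖g‖ₑ
  have hK : K ≠ ⊤ := by
    simp only [K]
    finiteness
  refine ⟨K.toReal, ENNReal.toReal_nonneg, fun v => ?_⟩
  rw [← ENNReal.ofReal_le_ofReal_iff (by positivity), enorm_weyl_sub]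
  have hlim' : ∀ᵐ z, Tendsto (fun n => weylFun v (u n) z - u n z) atTop
      (𝓝 (weylFun v g z - g z)) := by
    filter_upwards [hlim, (measurePreserving_add_right volume v).quasiMeasurePreserving.ae hlim]
      with z h1 h2
    exact (h2.const_mul _).sub h1
  -- Fatou: the L² norm is lower semicontinuous under almost everywhere convergence.
  refine (Lp.eLpNorm_lim_le_liminf_eLpNorm (fun n => ?_) _ hlim').trans ?_
  · have h1 := (hu n).continuous.aestronglyMeasurable (μ := (volume : Measure ℂ))
    exact (aestronglyMeasurable_weylFun v h1).sub h1
  · refine liminf_le_of_le (by isBoundedDefault) fun b hb => ?_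
    obtain ⟨n, hn⟩ := hb.exists
    refine hn.trans ((eLpNorm_weylFun_sub_le_classicalZ hσ v (hu n) (huc n)).trans ?_)
    rw [ENNReal.ofReal_mul ENNReal.toReal_nonneg, ENNReal.ofReal_toReal hK, ofReal_norm,
      mul_comm K]
    gcongr
    exact add_le_add (by gcongr; exact hZ n) (hu2 n)

theorem zMemL2_iff_weylLip (g : L2C) : ZMemL2 g ↔ WeylLip g :=
  (zMemL2_iff g).trans ⟨fun ⟨_, H⟩ => H.weylLip (by norm_num), fun h => h.exists_isWeakZ 1⟩

theorem zbarMemL2_iff_weylLip (g : L2C) : ZbarMemL2 g ↔ WeylLip g :=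
  (zbarMemL2_iff g).trans ⟨fun ⟨_, H⟩ => H.weylLip (by norm_num), fun h => h.exists_isWeakZ (-1)⟩

/-! ### Bessel families and their synthesis operators -/

/-- Square summable sequences. -/
abbrev SeqL2 (ι : Type*) : Type _ := lp (fun _ : ι => ℂ) 2

section Abstract

variable {ι : Type*} {H : Type*} [NormedAddCommGroup H] [InnerProductSpace ℂ H]

theorem hasSum_norm_sq_seqL2 (x : SeqL2 ι) : HasSum (fun i => ‖x i‖ ^ 2) (‖x‖ ^ 2) := by
  have := lp.hasSum_norm (p := 2) (by norm_num) x
  simpa using this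

/-- Bessel families. -/
def IsBessel (K : ℝ) (f : ι → H) : Prop :=
  ∀ x, Summable (fun i => ‖inner ℂ (f i) x‖ ^ 2) ∧ ∑' i, ‖inner ℂ (f i) x‖ ^ 2 ≤ K * ‖x‖ ^ 2

theorem IsBessel.mono {K K' : ℝ} (h : K ≤ K') {f : ι → H} (hf : IsBessel K f) : IsBessel K' f :=
  fun x => ⟨(hf x).1, (hf x).2.trans (by gcongr)⟩

theorem IsBessel.exists_analysis {K : ℝ} (hK : 0 ≤ K) {f : ι → H} (hf : IsBessel K f) :
    ∃ C : H →L[ℂ] SeqL2 ι, (∀ x i, C x i = inner ℂ (f i) x) ∧ ‖C‖ ≤ √K := by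
  have hmem : ∀ x, Memℓp (fun i => inner ℂ (f i) x) 2 := fun x =>
    memℓp_gen (by simpa using (hf x).1)
  let L : H →ₗ[ℂ] SeqL2 ι :=
    { toFun := fun x => ⟨fun i => inner ℂ (f i) x, hmem x⟩
      map_add' := fun x y => by
        ext i
        exact inner_add_right _ _ _
      map_smul' := fun c x => by
        ext i
        exact inner_smul_right _ _ _ }
  have hL : ∀ x i, L x i = inner ℂ (f i) x := fun x i => rfl
  have hb : ∀ x, ‖L x‖ ≤ √K * ‖x‖ := fun x => by
    rw [← pow_le_pow_iff_left₀ (norm_nonneg _) (by positivity) two_ne_zero, mul_pow,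
      Real.sq_sqrt hK, ← (hasSum_norm_sq_seqL2 (L x)).tsum_eq]
    exact (hf x).2
  exact ⟨L.mkContinuous _ hb, hL, L.mkContinuous_norm_le (Real.sqrt_nonneg K) hb⟩

variable [DecidableEq ι]

/-- The standard basis of `ℓ²`. -/
def seqBasis (i : ι) : SeqL2 ι := lp.single 2 i (1 : ℂ)

theorem inner_seqBasis_left (i : ι) (x : SeqL2 ι) : inner ℂ (seqBasis i) x = x i := by
  rw [seqBasis, lp.inner_single_left]
  simp

theorem inner_seqBasis_right (i : ι) (x : SeqL2 ι) : inner ℂ x (seqBasis i) = conj (x i) := by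
  rw [← inner_conj_symm, inner_seqBasis_left]

theorem seqBasis_apply (i j : ι) : seqBasis i j = if j = i then 1 else 0 := by
  rw [seqBasis, lp.single_apply, Pi.single_apply]

theorem norm_seqBasis (i : ι) : ‖seqBasis i‖ = 1 := by
  rw [seqBasis, lp.norm_single (by norm_num)]
  simp

theorem hasSum_smul_seqBasis (x : SeqL2 ι) : HasSum (fun i => x i • seqBasis i) x := by
  refine (lp.hasSum_single (by norm_num) x).congr_fun fun i => ?_
  rw [seqBasis, ← lp.single_smul]
  simp

theorem seqL2_clm_ext {F : Type*} [NormedAddCommGroup F] [NormedSpace ℂ F]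
    {X Y : SeqL2 ι →L[ℂ] F} (h : ∀ i, X (seqBasis i) = Y (seqBasis i)) : X = Y := by
  ext x
  have h1 := (hasSum_smul_seqBasis x).mapL X
  have h2 := (hasSum_smul_seqBasis x).mapL Y
  simp only [map_smul, h] at h1 h2
  exact h1.unique h2

theorem IsBessel.exists_synthesis [CompleteSpace H] {K : ℝ} (hK : 0 ≤ K) {f : ι → H}
    (hf : IsBessel K f) : ∃ S : SeqL2 ι →L[ℂ] H, (∀ i, S (seqBasis i) = f i) ∧ ‖S‖ ≤ √K := by
  obtain ⟨C, hC, hn⟩ := hf.exists_analysis hK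
  refine ⟨C.adjoint, fun i => ext_inner_right ℂ fun x => ?_, by simpa using hn⟩
  rw [ContinuousLinearMap.adjoint_inner_left, inner_seqBasis_left, hC]

theorem isBessel_of_clm [CompleteSpace H] {f : ι → H} (S : SeqL2 ι →L[ℂ] H)
    (hS : ∀ i, S (seqBasis i) = f i) : IsBessel (‖S‖ ^ 2) f := fun x => by
  have h : ∀ i, S.adjoint x i = inner ℂ (f i) x := fun i => by
    rw [← inner_seqBasis_left, ContinuousLinearMap.adjoint_inner_right, hS]
  have h1 := hasSum_norm_sq_seqL2 (S.adjoint x)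
  simp_rw [h] at h1
  refine ⟨h1.summable, h1.tsum_eq.trans_le ?_⟩
  rw [← mul_pow]
  gcongr
  simpa using S.adjoint.le_opNorm x

/-! ### Toeplitz operators -/

/-- Toeplitz operators on `ℓ²` of a group. -/
def IsToeplitz [AddCommGroup ι] (X : SeqL2 ι →L[ℂ] SeqL2 ι) : Prop :=
  ∃ x : ι → ℂ, ∀ k l, inner ℂ (seqBasis k) (X (seqBasis l)) = x (k - l)

/-- Both products are convolutions on an abelian group; the substitution of k + l - j for j
interchanges the factors. -/
theorem IsToeplitz.commute [AddCommGroup ι] {X Y : SeqL2 ι →L[ℂ] SeqL2 ι} (hX : IsToeplitz X)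
    (hY : IsToeplitz Y) : Commute X Y := by
  have key : ∀ (X Y : SeqL2 ι →L[ℂ] SeqL2 ι) (k l : ι),
      (X * Y) (seqBasis l) k = ∑' j, inner ℂ (seqBasis j) (Y (seqBasis l)) *
        inner ℂ (seqBasis k) (X (seqBasis j)) := fun X Y k l => by
    rw [← inner_seqBasis_left, mul_apply_eq_comp,
      ← ContinuousLinearMap.adjoint_inner_left, lp.inner_eq_tsum]
    refine tsum_congr fun j => ?_
    rw [RCLike.inner_apply, ← inner_seqBasis_left, ← inner_seqBasis_right,
      ContinuousLinearMap.adjoint_inner_left]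
  obtain ⟨x, hx⟩ := hX
  obtain ⟨y, hy⟩ := hY
  refine seqL2_clm_ext fun l => ?_
  ext k
  rw [key, key, ← (Equiv.subLeft (k + l)).tsum_eq]
  refine tsum_congr fun j => ?_
  simp only [hx, hy, Equiv.subLeft_apply]
  rw [mul_comm]
  congr 2 <;> abel

/-! ### Perturbation of dual Riesz sequences -/

/-- `a` and `b` are biorthogonal Riesz sequences with the same span. -/
structure IsRieszDual (K : ℝ) (a b : ι → H) : Prop where
  bessel_left : IsBessel K a
  bessel_right : IsBessel K b
  inner_eq : ∀ k l, inner ℂ (a k) (b l) = if k = l then (1 : ℂ) else 0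
  hasSum_right : ∀ l, HasSum (fun k => (inner ℂ (b k) (b l) : ℂ) • a k) (b l)
  hasSum_left : ∀ l, HasSum (fun k => (inner ℂ (a k) (a l) : ℂ) • b k) (a l)

theorem IsRieszDual.symm {K : ℝ} {a b : ι → H} (h : IsRieszDual K a b) : IsRieszDual K b a where
  bessel_left := h.bessel_right
  bessel_right := h.bessel_left
  inner_eq k l := by
    rw [← inner_conj_symm, h.inner_eq]
    split_ifs with h1 h2 h2 <;> simp_all
  hasSum_right := h.hasSum_left
  hasSum_left := h.hasSum_right

/-- The Gram matrix of two families is shift invariant. -/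
def IsShiftInvariant [AddCommGroup ι] (a b : ι → H) : Prop :=
  ∃ x : ι → ℂ, ∀ k l, inner ℂ (a k) (b l) = x (k - l)

theorem IsShiftInvariant.isToeplitz [AddCommGroup ι] [CompleteSpace H] {a b : ι → H}
    (h : IsShiftInvariant a b) {S R : SeqL2 ι →L[ℂ] H} (hS : ∀ i, S (seqBasis i) = a i)
    (hR : ∀ i, R (seqBasis i) = b i) : IsToeplitz (S.adjoint ∘L R) := by
  obtain ⟨x, hx⟩ := h
  refine ⟨x, fun k l => ?_⟩
  rw [ContinuousLinearMap.comp_apply, ContinuousLinearMap.adjoint_inner_right, hS, hR, hx]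

/-- The coefficients of b_j in its expansion along a are the j-th column of the Gram matrix of b, so
synthesis with b is synthesis with a after that Gram operator. -/
theorem IsRieszDual.range_eq [CompleteSpace H] {K : ℝ} {a b : ι → H} (h : IsRieszDual K a b)
    {S R : SeqL2 ι →L[ℂ] H} (hS : ∀ i, S (seqBasis i) = a i) (hR : ∀ i, R (seqBasis i) = b i)
    (j : ι) : R (seqBasis j) = S ((R.adjoint ∘L R) (seqBasis j)) := by
  have e := (hasSum_smul_seqBasis ((R.adjoint ∘L R) (seqBasis j))).mapL S
  have e2 : ∀ k, (R.adjoint ∘L R) (seqBasis j) k = inner ℂ (b k) (b j) := fun k => by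
    rw [← inner_seqBasis_left, ContinuousLinearMap.comp_apply,
      ContinuousLinearMap.adjoint_inner_right, hR, hR]
  simp only [map_smul, hS, e2] at e
  rw [hR]
  exact (h.hasSum_right j).unique e

theorem IsRieszDual.adjoint_comp [CompleteSpace H] {K : ℝ} {a b : ι → H} (h : IsRieszDual K a b)
    {S R : SeqL2 ι →L[ℂ] H} (hS : ∀ i, S (seqBasis i) = a i) (hR : ∀ i, R (seqBasis i) = b i) :
    S.adjoint ∘L R = 1 := by
  refine seqL2_clm_ext fun l => ?_
  ext k
  rw [← inner_seqBasis_left, ContinuousLinearMap.comp_apply,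
    ContinuousLinearMap.adjoint_inner_right, hS, hR, h.inner_eq, one_apply_eq_self,
    seqBasis_apply]

/-- For commuting operators `M, N ≥ 0` one has `M N ≤ ‖M‖ N`. -/
theorem inner_mul_le_of_commute {E : Type*} [NormedAddCommGroup E] [InnerProductSpace ℂ E]
    [CompleteSpace E] {M N : E →L[ℂ] E} (hM : IsSelfAdjoint M) (hN : 0 ≤ N) (h : Commute M N)
    (x : E) : (inner ℂ x ((M * N) x)).re ≤ ‖M‖ * (inner ℂ x (N x)).re := by
  have h1 : 0 ≤ algebraMap ℝ (E →L[ℂ] E) ‖M‖ - M := sub_nonneg.2 hM.le_algebraMap_norm_self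
  have h2 : Commute (algebraMap ℝ (E →L[ℂ] E) ‖M‖ - M) N :=
    (Algebra.commute_algebraMap_left ‖M‖ N).sub_left h
  -- A product of commuting nonnegative operators is nonnegative; here the factors are ‖M‖ - M and
  -- N.
  have h3 := h2.mul_nonneg h1 hN
  rw [ContinuousLinearMap.nonneg_iff_isPositive] at h3
  have h4 := h3.inner_nonneg_right x
  rw [sub_mul, Algebra.algebraMap_eq_smul_one, smul_mul_assoc, one_mul,
    sub_apply, smul_apply, inner_sub_right] at h4
  have h5 := (Complex.le_def.1 h4).1
  have h6 : inner ℂ x (‖M‖ • N x) = (‖M‖ : ℂ) * inner ℂ x (N x) := by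
    rw [← inner_smul_right]; rfl
  rw [h6, Complex.sub_re, Complex.re_ofReal_mul] at h5
  simpa using h5

/-- An operator form of |1/x̄ - 1/ȳ|² = |x - y|² / (|x|²|y|²). The dual Gram operators M₁, M₂ play
the roles of 1/|x|² and 1/|y|², while N = (S₁ - S₂)*(S₁ - S₂) plays that of |x - y|². Everything
commutes, so the squared distance of the duals is ⟨d, M₁M₂N d⟩ ≤ ‖M₁M₂‖⟨d, N d⟩, and ‖M₁M₂‖ ≤ K². -/
theorem IsRieszDual.norm_sub_le [AddCommGroup ι] [CompleteSpace H] {K : ℝ} (hK : 0 ≤ K)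
    {a₁ b₁ a₂ b₂ : ι → H} (h₁ : IsRieszDual K a₁ b₁) (h₂ : IsRieszDual K a₂ b₂)
    (haa₁ : IsShiftInvariant a₁ a₁) (haa₂ : IsShiftInvariant a₂ a₂)
    (hbb₁ : IsShiftInvariant b₁ b₁) (hbb₂ : IsShiftInvariant b₂ b₂)
    (haa₁₂ : IsShiftInvariant a₁ a₂) (haa₂₁ : IsShiftInvariant a₂ a₁) (j : ι) :
    ‖b₁ j - b₂ j‖ ≤ K * ‖a₁ j - a₂ j‖ := by
  obtain ⟨S₁, hS₁, -⟩ := h₁.bessel_left.exists_synthesis hK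
  obtain ⟨S₂, hS₂, -⟩ := h₂.bessel_left.exists_synthesis hK
  obtain ⟨R₁, hR₁, nR₁⟩ := h₁.bessel_right.exists_synthesis hK
  obtain ⟨R₂, hR₂, nR₂⟩ := h₂.bessel_right.exists_synthesis hK
  set M₁ : SeqL2 ι →L[ℂ] SeqL2 ι := R₁.adjoint ∘L R₁ with hM₁
  set M₂ : SeqL2 ι →L[ℂ] SeqL2 ι := R₂.adjoint ∘L R₂ with hM₂
  set G₁ : SeqL2 ι →L[ℂ] SeqL2 ι := S₁.adjoint ∘L S₁ with hG₁
  set G₂ : SeqL2 ι →L[ℂ] SeqL2 ι := S₂.adjoint ∘L S₂ with hG₂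
  set X : SeqL2 ι →L[ℂ] SeqL2 ι := S₁.adjoint ∘L S₂ with hX
  set Y : SeqL2 ι →L[ℂ] SeqL2 ι := S₂.adjoint ∘L S₁ with hY
  have tM₁ := hbb₁.isToeplitz hR₁ hR₁
  have tM₂ := hbb₂.isToeplitz hR₂ hR₂
  have tG₁ := haa₁.isToeplitz hS₁ hS₁
  have tG₂ := haa₂.isToeplitz hS₂ hS₂
  have tX := haa₁₂.isToeplitz hS₁ hS₂
  have tY := haa₂₁.isToeplitz hS₂ hS₁
  rw [← hM₁] at tM₁
  rw [← hM₂] at tM₂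
  rw [← hG₁] at tG₁
  rw [← hG₂] at tG₂
  rw [← hX] at tX
  rw [← hY] at tY
  have cM := tM₁.commute tM₂
  set N : SeqL2 ι →L[ℂ] SeqL2 ι := (S₁ - S₂).adjoint ∘L (S₁ - S₂) with hN
  have eN : N = G₁ + G₂ - X - Y := by
    refine ContinuousLinearMap.ext fun x => ?_
    simp only [hN, hG₁, hG₂, hX, hY, map_sub, ContinuousLinearMap.comp_apply,
      sub_apply, add_apply]
    abel
  have cN : Commute (M₁ * M₂) N := by
    have : ∀ Z, IsToeplitz Z → Commute (M₁ * M₂) Z := fun Z hZ =>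
      (tM₁.commute hZ).mul_left (tM₂.commute hZ)
    rw [eN]
    exact (((this _ tG₁).add_right (this _ tG₂)).sub_right (this _ tX)).sub_right (this _ tY)
  have sM : ∀ R : SeqL2 ι →L[ℂ] H, IsSelfAdjoint (R.adjoint ∘L R) := fun R =>
    (ContinuousLinearMap.isPositive_adjoint_comp_self R).isSelfAdjoint
  have hMM : IsSelfAdjoint (M₁ * M₂) := ((sM R₁).commute_iff (sM R₂)).1 cM
  have hN0 : 0 ≤ N := (ContinuousLinearMap.nonneg_iff_isPositive _).2
    (ContinuousLinearMap.isPositive_adjoint_comp_self _)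
  have hnorm : ∀ R : SeqL2 ι →L[ℂ] H, ‖R‖ ≤ √K → ‖R.adjoint ∘L R‖ ≤ K := fun R hR => by
    refine (ContinuousLinearMap.opNorm_comp_le _ _).trans ?_
    rw [LinearIsometryEquiv.norm_map]
    calc ‖R‖ * ‖R‖ ≤ √K * √K := by gcongr
      _ = K := Real.mul_self_sqrt hK
  have nMM : ‖M₁ * M₂‖ ≤ K * K := (norm_mul_le _ _).trans
    (mul_le_mul (hnorm R₁ nR₁) (hnorm R₂ nR₂) (norm_nonneg _) hK)
  set d : SeqL2 ι := seqBasis j with hd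
  have r₁ : b₁ j = S₁ (M₁ d) := (hR₁ j).symm.trans (h₁.range_eq hS₁ hR₁ j)
  have r₂ : b₂ j = S₂ (M₂ d) := (hR₂ j).symm.trans (h₂.range_eq hS₂ hR₂ j)
  have g₁ : G₁ (M₁ d) = d := by
    rw [hG₁, ContinuousLinearMap.comp_apply, ← r₁, ← hR₁, ← ContinuousLinearMap.comp_apply,
      h₁.adjoint_comp hS₁ hR₁]
    rfl
  have g₂ : G₂ (M₂ d) = d := by
    rw [hG₂, ContinuousLinearMap.comp_apply, ← r₂, ← hR₂, ← ContinuousLinearMap.comp_apply,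
      h₂.adjoint_comp hS₂ hR₂]
    rfl
  have comm : ∀ {A B : SeqL2 ι →L[ℂ] SeqL2 ι}, Commute A B → ∀ x, A (B x) = B (A x) :=
    fun h x => congrArg (fun T : SeqL2 ι →L[ℂ] SeqL2 ι => T x) h.eq
  have sym : ∀ (R : SeqL2 ι →L[ℂ] H) (x y : SeqL2 ι),
      inner ℂ ((R.adjoint ∘L R) x) y = inner ℂ x ((R.adjoint ∘L R) y) := fun R x y => by
    simp [ContinuousLinearMap.adjoint_inner_left, ContinuousLinearMap.adjoint_inner_right]
  -- To give all four inner products the common factor M₁M₂, the identity is inserted in the form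
  -- G₂M₂ here and G₁M₁ in the next; compare 1/|x|² = |y|² / (|x|²|y|²). The mixed products acquire
  -- it directly, as b_i = S_i M_i d.
  have i₁ : inner ℂ (b₁ j) (b₁ j) = inner ℂ d (M₁ (M₂ (G₂ d))) := by
    rw [comm (tM₂.commute tG₂), g₂, hM₁, ContinuousLinearMap.comp_apply,
      ContinuousLinearMap.adjoint_inner_right, hd, hR₁]
  have i₂ : inner ℂ (b₂ j) (b₂ j) = inner ℂ d (M₁ (M₂ (G₁ d))) := by
    rw [comm cM, comm (tM₁.commute tG₁), g₁, hM₂, ContinuousLinearMap.comp_apply,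
      ContinuousLinearMap.adjoint_inner_right, hd, hR₂]
  have i₃ : inner ℂ (b₁ j) (b₂ j) = inner ℂ d (M₁ (M₂ (X d))) := by
    rw [r₁, r₂, ← ContinuousLinearMap.adjoint_inner_right, comm (tM₂.commute tX), hM₁, sym]
    rfl
  have i₄ : inner ℂ (b₂ j) (b₁ j) = inner ℂ d (M₁ (M₂ (Y d))) := by
    rw [r₁, r₂, ← ContinuousLinearMap.adjoint_inner_right, comm cM, comm (tM₁.commute tY), hM₂, sym]
    rfl
  have main : inner ℂ (b₁ j - b₂ j) (b₁ j - b₂ j) = inner ℂ d ((M₁ * M₂ * N) d) := by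
    rw [inner_sub_left, inner_sub_right, inner_sub_right, i₁, i₂, i₃, i₄, eN]
    simp only [mul_apply_eq_comp, sub_apply, add_apply,
      map_sub, map_add, inner_sub_right, inner_add_right]
    ring
  have eNd : inner ℂ d (N d) = inner ℂ (a₁ j - a₂ j) (a₁ j - a₂ j) := by
    rw [hN, ContinuousLinearMap.comp_apply, ContinuousLinearMap.adjoint_inner_right,
      sub_apply, hd, hS₁, hS₂]
  have bound := inner_mul_le_of_commute hMM hN0 cN d
  have hre : ∀ x : H, (inner ℂ x x).re = ‖x‖ ^ 2 := inner_self_eq_norm_sq (𝕜 := ℂ)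
  rw [← main, eNd, hre, hre] at bound
  rw [← pow_le_pow_iff_left₀ (norm_nonneg _) (by positivity) two_ne_zero, mul_pow]
  refine bound.trans ?_
  rw [sq K]
  gcongr

end Abstract

section Abstract

variable {ι : Type*} {H : Type*} [NormedAddCommGroup H] [InnerProductSpace ℂ H]

/-! ### Exact frames are Riesz bases -/

/-- The frame bound only tests vectors of V, but the family lies in V, so an arbitrary vector may be
replaced by its orthogonal projection. -/
theorem IsFrameFor.exists_isBessel {V : Submodule ℂ H} [V.HasOrthogonalProjection] {f : ι → H}
    (hf : IsFrameFor V f) : ∃ K, 0 ≤ K ∧ IsBessel K f := by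
  obtain ⟨hV, A, B, hA, hB, h⟩ := hf
  refine ⟨B, hB.le, fun x => ?_⟩
  have e : ∀ i, inner ℂ (f i) x = inner ℂ (f i) (V.starProjection x) := fun i => by
    rw [← V.inner_starProjection_left_eq_right, V.starProjection_eq_self_iff.2 (hV i)]
  obtain ⟨h1, -, h2⟩ := h _ (V.starProjection_apply_mem x)
  simp_rw [e]
  refine ⟨h1, h2.trans ?_⟩
  gcongr
  exact V.norm_starProjection_apply_le x

variable [DecidableEq ι]

/-- If the analysis sequence of `h` is the projection of the `j`-th basis vector but differs from
it at `j`, then the `j`-th element can be deleted from a frame. -/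
theorem IsFrameFor.delete {V : Submodule ℂ H} {f : ι → H} (hf : IsFrameFor V f)
    (C : H →L[ℂ] SeqL2 ι) (hC : ∀ x i, C x i = inner ℂ (f i) x) (j : ι) (h : H)
    (hproj : ∀ x ∈ V, inner ℂ (C x) (C h) = inner ℂ (C x) (seqBasis j)) (hne : C h j ≠ 1) :
    IsFrameFor V (fun i : {i : ι // i ≠ j} => f i) := by
  obtain ⟨hV, A, B, hA, hB, H'⟩ := hf
  have hpos : 0 < ‖1 - C h j‖ := norm_pos_iff.2 (sub_ne_zero.2 hne.symm)
  let D : ℝ := 1 + ‖C h‖ / ‖1 - C h j‖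
  have hD : 0 < D := by positivity
  refine ⟨fun i => hV i, A / D ^ 2, B, by positivity, hB, fun x hx => ?_⟩
  obtain ⟨h1, h2, h3⟩ := H' x hx
  refine ⟨h1.subtype _, ?_, (Summable.tsum_subtype_le _ {i | i ≠ j} (fun i => by positivity)
    h1).trans h3⟩
  let y : SeqL2 ι := C x - C x j • seqBasis j
  have hy : ∀ i, y i = if i = j then 0 else C x i := fun i => by
    have : y i = C x i - C x j * seqBasis j i := rfl
    rw [this, seqBasis_apply]
    split_ifs with hi
    · rw [hi]; ring
    · ring
  have e1 : ∑' i : {i : ι // i ≠ j}, ‖inner ℂ (f i) x‖ ^ 2 = ‖y‖ ^ 2 := by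
    rw [← (hasSum_norm_sq_seqL2 y).tsum_eq]
    refine (tsum_subtype {i | i ≠ j} (fun i => ‖inner ℂ (f i) x‖ ^ 2)).trans
      (tsum_congr fun i => ?_)
    rw [hy, hC]
    by_cases hi : i = j <;> simp [hi]
  have e2 : ∑' i, ‖inner ℂ (f i) x‖ ^ 2 = ‖C x‖ ^ 2 := by
    rw [← (hasSum_norm_sq_seqL2 (C x)).tsum_eq]
    simp_rw [hC]
  -- Here y is the analysis sequence of x with its j-th entry removed. Since C h j ≠ 1, pairing y
  -- with C h recovers the missing entry, which is thus controlled by the remaining ones; D is the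
  -- resulting constant.
  have e3 : inner ℂ y (C h) = conj (C x j) * (1 - C h j) := by
    have : y = C x - C x j • seqBasis j := rfl
    rw [this, inner_sub_left, inner_smul_left, inner_seqBasis_left, hproj x hx,
      inner_seqBasis_right]
    ring
  have e4 : ‖C x j‖ ≤ ‖C h‖ / ‖1 - C h j‖ * ‖y‖ := by
    rw [div_mul_eq_mul_div, le_div_iff₀ hpos]
    calc ‖C x j‖ * ‖1 - C h j‖ = ‖inner ℂ y (C h)‖ := by rw [e3, norm_mul, RCLike.norm_conj]
      _ ≤ ‖y‖ * ‖C h‖ := norm_inner_le_norm _ _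
      _ = _ := mul_comm _ _
  have e5 : ‖C x‖ ≤ D * ‖y‖ := by
    have : C x = y + C x j • seqBasis j := (sub_add_cancel _ _).symm
    rw [this]
    refine (norm_add_le _ _).trans ?_
    rw [norm_smul, norm_seqBasis, mul_one]
    simp only [D]
    linarith
  rw [e1, div_mul_eq_mul_div, div_le_iff₀ (by positivity)]
  rw [e2] at h2
  refine h2.trans ?_
  rw [mul_comm, ← mul_pow]
  gcongr

/-- The analysis operator on V is bounded below, so its range W is closed. Project a basis vector
onto W: unless the j-th entry of the projection is 1, the j-th frame element can be deleted.
Exactness therefore puts every basis vector in W, the analysis operator is an isomorphism of V onto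
ℓ², and its inverse sends the basis to the biorthogonal family. -/
theorem IsExactFrameFor.exists_biorthogonal [CompleteSpace H] {V : Submodule ℂ H}
    (hV : IsClosed (V : Set H)) {f : ι → H} (hf : IsExactFrameFor V f) :
    ∃ (h : ι → H) (K : ℝ), 0 ≤ K ∧ (∀ j, h j ∈ V) ∧
      (∀ i j, inner ℂ (f i) (h j) = if i = j then (1 : ℂ) else 0) ∧ IsBessel K f ∧
      IsBessel K h := by
  have : CompleteSpace V := hV.completeSpace_coe
  obtain ⟨hfr, hex⟩ := hf
  obtain ⟨K, hK, hb⟩ := hfr.exists_isBessel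
  obtain ⟨C, hC, -⟩ := hb.exists_analysis hK
  let CV : V →L[ℂ] SeqL2 ι := C ∘L V.subtypeL
  have hCV : ∀ x : V, CV x = C x := fun x => rfl
  obtain ⟨A, B, hA, hB, hAB⟩ := hfr.2
  have hbelow : ∀ x : V, ‖x‖ ≤ (√A)⁻¹ * ‖CV x‖ := fun x => by
    have h1 := (hAB x x.2).2.1
    have e2 : ∑' i, ‖inner ℂ (f i) (x : H)‖ ^ 2 = ‖C x‖ ^ 2 := by
      rw [← (hasSum_norm_sq_seqL2 (C x)).tsum_eq]
      simp_rw [hC]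
    rw [e2] at h1
    have hs : 0 < √A := Real.sqrt_pos.2 hA
    rw [← div_eq_inv_mul, le_div_iff₀ hs,
      ← pow_le_pow_iff_left₀ (by positivity) (norm_nonneg _) two_ne_zero, mul_pow,
      Real.sq_sqrt hA.le, mul_comm]
    exact h1
  have hanti : AntilipschitzWith (Real.toNNReal (√A)⁻¹) CV :=
    AddMonoidHomClass.antilipschitz_of_bound CV fun x => by
      rw [Real.coe_toNNReal _ (by positivity)]
      exact hbelow x
  have hcl : IsClosed (Set.range CV) := hanti.isClosed_range CV.uniformContinuous
  let W : Submodule ℂ (SeqL2 ι) := CV.range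
  have hW : IsClosed (W : Set (SeqL2 ι)) := hcl
  have : CompleteSpace W := hW.completeSpace_coe
  have hmem : ∀ j, seqBasis j ∈ W := fun j => by
    obtain ⟨h, hh⟩ : W.starProjection (seqBasis j) ∈ W := W.starProjection_apply_mem _
    have hh' : C h = W.starProjection (seqBasis j) := hh
    have hproj : ∀ x ∈ V, inner ℂ (C x) (C h) = inner ℂ (C x) (seqBasis j) := fun x hx => by
      have hx' : C x ∈ W := ⟨⟨x, hx⟩, rfl⟩
      rw [hh', ← W.inner_starProjection_left_eq_right, W.starProjection_eq_self_iff.2 hx']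
    have h1 : C h j = 1 := by
      by_contra hne
      exact hex j (hfr.delete C hC j h hproj hne)
    -- The j-th entry of the projection is also its squared norm, so the projection has the same
    -- norm as the basis vector and must equal it.
    have h2 : ‖C h‖ ^ 2 = 1 := by
      have e := hproj h h.2
      rw [inner_seqBasis_right, h1, map_one] at e
      rw [← inner_self_eq_norm_sq (𝕜 := ℂ), e, RCLike.one_re]
    have h3 : C h = seqBasis j := by
      rw [← sub_eq_zero, ← norm_eq_zero, ← sq_eq_zero_iff, @norm_sub_sq ℂ, h2,
        inner_seqBasis_right, h1, norm_seqBasis]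
      simp
      norm_num
    exact ⟨h, h3⟩
  have hsurj : Function.Surjective CV := by
    intro y
    have h1 : y ∈ closure (W : Set (SeqL2 ι)) :=
      mem_closure_of_tendsto (hasSum_smul_seqBasis y)
        (Eventually.of_forall fun s => W.sum_mem fun i _ => W.smul_mem _ (hmem i))
    rw [hW.closure_eq] at h1
    exact h1
  let E := ContinuousLinearEquiv.ofBijective CV (LinearMap.ker_eq_bot.2 hanti.injective)
    (LinearMap.range_eq_top.2 hsurj)
  let R : SeqL2 ι →L[ℂ] H := V.subtypeL ∘L (E.symm : SeqL2 ι →L[ℂ] V)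
  have hR : ∀ x, C (R x) = x := fun x => E.apply_symm_apply x
  refine ⟨fun j => R (seqBasis j), max K (‖R‖ ^ 2), hK.trans (le_max_left _ _),
    fun j => (E.symm (seqBasis j)).2, fun i j => ?_, hb.mono (le_max_left _ _),
    (isBessel_of_clm R fun _ => rfl).mono (le_max_right _ _)⟩
  rw [← hC, hR, seqBasis_apply]

/-- Expanding a biorthogonal vector h_j by the first reconstruction formula leaves only the term
b_j, so the given dual family is the biorthogonal one. -/
theorem IsExactFrameFor.exists_isRieszDual [CompleteSpace H] {V : Submodule ℂ H}
    (hV : IsClosed (V : Set H)) {a b : ι → H} (ha : IsExactFrameFor V a)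
    (h₁ : ∀ x ∈ V, HasSum (fun k => (inner ℂ (a k) x : ℂ) • b k) x)
    (h₂ : ∀ x ∈ V, HasSum (fun k => (inner ℂ (b k) x : ℂ) • a k) x) :
    ∃ K, 0 ≤ K ∧ IsRieszDual K a b := by
  obtain ⟨h, K, hK, hhV, hbi, hB, hB'⟩ := ha.exists_biorthogonal hV
  have e : b = h := funext fun j => by
    have e1 := h₁ (h j) (hhV j)
    have e2 : HasSum (fun k => (inner ℂ (a k) (h j) : ℂ) • b k) (b j) := by
      have e3 := hasSum_single (f := fun k => (inner ℂ (a k) (h j) : ℂ) • b k) j fun k hk => by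
        simp [hbi, hk]
      simpa [hbi] using e3
    exact e2.unique e1
  subst e
  exact ⟨K, hK, hB, hB', hbi, fun l => h₂ _ (hhV l), fun l => h₁ _ (ha.1.1 l)⟩

/-- Riesz sequences are preserved by isometries and unimodular factors. -/
theorem IsRieszDual.map [CompleteSpace H] {K : ℝ} (hK : 0 ≤ K) {a b : ι → H}
    (h : IsRieszDual K a b) (U : H →ₗᵢ[ℂ] H) (c : ι → ℂ) (hc : ∀ k, ‖c k‖ = 1) :
    IsRieszDual K (fun k => c k • U (a k)) (fun k => c k • U (b k)) := by
  have hcc : ∀ k, c k * conj (c k) = 1 := fun k => by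
    rw [Complex.mul_conj, Complex.normSq_eq_norm_sq, hc]; simp
  have hbes : ∀ a : ι → H, IsBessel K a → IsBessel K (fun k => c k • U (a k)) := fun a ha x => by
    have e : ∀ k, ‖inner ℂ (c k • U (a k)) x‖ =
        ‖inner ℂ (a k) (U.toContinuousLinearMap.adjoint x)‖ := fun k => by
      rw [inner_smul_left, norm_mul, RCLike.norm_conj, hc, one_mul,
        ContinuousLinearMap.adjoint_inner_right]
      rfl
    simp_rw [e]
    refine ⟨(ha _).1, (ha _).2.trans ?_⟩
    gcongr
    refine (ContinuousLinearMap.le_opNorm _ x).trans (mul_le_of_le_one_left (norm_nonneg x) ?_)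
    rw [LinearIsometryEquiv.norm_map]
    exact U.norm_toContinuousLinearMap_le
  have hsum : ∀ a b : ι → H, (∀ l, HasSum (fun k => (inner ℂ (b k) (b l) : ℂ) • a k) (b l)) →
      ∀ l, HasSum (fun k => (inner ℂ (c k • U (b k)) (c l • U (b l)) : ℂ) • c k • U (a k))
        (c l • U (b l)) := fun a b hs l => by
    have := ((hs l).mapL U.toContinuousLinearMap).const_smul (c l)
    refine this.congr_fun fun k => ?_
    rw [inner_smul_left, inner_smul_right, LinearIsometry.inner_map_map, map_smul, smul_smul,
      smul_smul]
    congr 1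
    linear_combination c l * inner ℂ (b k) (b l) * hcc k
  refine ⟨hbes a h.bessel_left, hbes b h.bessel_right, fun k l => ?_, hsum a b h.hasSum_right,
    hsum b a h.hasSum_left⟩
  rw [inner_smul_left, inner_smul_right, LinearIsometry.inner_map_map, h.inner_eq]
  split_ifs with hkl
  · rw [hkl, mul_one, mul_comm, hcc]
  · simp

end Abstract

/-! ### Twisted Gabor systems under Weyl operators -/

theorem coeFn_twistedTranslate (k : ℤ × ℤ) (g : L2C) :
    twistedTranslate k g =ᵐ[volume] twistedTranslateFun k g := MemLp.coeFn_toLp _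

theorem norm_weyl (v : ℂ) (g : L2C) : ‖weyl v g‖ = ‖g‖ := by
  rw [Lp.norm_def, Lp.norm_def]
  congr 1
  rw [eLpNorm_congr_ae (coeFn_weyl v g), ← eLpNorm_comp_measurePreserving
    (Lp.aestronglyMeasurable g) (measurePreserving_add_right volume v)]
  exact eLpNorm_congr_norm_ae (Eventually.of_forall fun z => norm_weylFun v g z)

/-- The Weyl operator as a linear isometry. -/
def weylIsometry (v : ℂ) : L2C →ₗᵢ[ℂ] L2C where
  toFun := weyl v
  map_add' f g := by
    refine Lp.ext ?_
    filter_upwards [coeFn_weyl v (f + g), Lp.coeFn_add (weyl v f) (weyl v g), coeFn_weyl v f,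
      coeFn_weyl v g, weylFun_ae_congr v (Lp.coeFn_add f g)] with z h1 h2 h3 h4 h5
    rw [h1, h2, Pi.add_apply, h3, h4, h5]
    simp only [weylFun, Pi.add_apply]
    ring
  map_smul' c f := by
    refine Lp.ext ?_
    filter_upwards [coeFn_weyl v (c • f), Lp.coeFn_smul c (weyl v f), coeFn_weyl v f,
      weylFun_ae_congr v (Lp.coeFn_smul c f)] with z h1 h2 h3 h4
    rw [h1, RingHom.id_apply, h2, Pi.smul_apply, h3, h4]
    simp only [weylFun, Pi.smul_apply, smul_eq_mul]
    ring
  norm_map' := norm_weyl v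

theorem twistedTranslateFun_ae_congr (k : ℤ × ℤ) {f f' : ℂ → ℂ} (h : f =ᵐ[volume] f') :
    twistedTranslateFun k f =ᵐ[volume] twistedTranslateFun k f' := by
  filter_upwards [(measurePreserving_sub_right volume
    (latticePoint k)).quasiMeasurePreserving.ae_eq_comp h] with z hz
  simp only [Function.comp_apply] at hz
  simp only [twistedTranslateFun, hz]

/-- The phase in the commutation relation of twisted translates and Weyl operators. -/
def weylPhase (v : ℂ) (k : ℤ × ℤ) : ℂ :=
  Complex.exp (((-(conj (latticePoint k) * v).im -
    2 * Real.pi * (k.2 * v.re - k.1 * v.im) : ℝ) : ℂ) * Complex.I)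

/-- The z-dependent phases on the two sides agree, so the discrepancy is a unimodular constant. The
system generated by `weyl v g` is thus an isometric image of the one generated by g, up to such
constants. -/
theorem twistedTranslate_weyl (v : ℂ) (k : ℤ × ℤ) (g : L2C) :
    twistedTranslate k (weyl v g) = weylPhase v k • weyl v (twistedTranslate k g) := by
  refine Lp.ext ?_
  filter_upwards [coeFn_twistedTranslate k (weyl v g),
    twistedTranslateFun_ae_congr k (coeFn_weyl v g),
    Lp.coeFn_smul (weylPhase v k) (weyl v (twistedTranslate k g)),
    coeFn_weyl v (twistedTranslate k g),
    weylFun_ae_congr v (coeFn_twistedTranslate k g)] with z h1 h2 h3 h4 h5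
  rw [h1, h2, h3, Pi.smul_apply, h4, h5]
  simp only [twistedTranslateFun, weylFun, smul_eq_mul, weylPhase, ← mul_assoc, ← Complex.exp_add]
  congr 2
  · rw [← add_mul, ← add_mul, ← add_mul]
    congr 1
    push_cast [Complex.add_re, Complex.add_im, Complex.mul_im, map_sub, Complex.sub_re,
      Complex.sub_im]
    ring
  · ring

/-- After translation by l the two sides differ by exp(2πi(k₁l₂ - k₂l₁)), which is 1 because the
symplectic form is integral on the lattice. -/
theorem isShiftInvariant_twistedTranslate (x y : L2C) :
    IsShiftInvariant (fun k => twistedTranslate k x) (fun k => twistedTranslate k y) := by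
  have hi : ∀ k l, inner ℂ (twistedTranslate k x) (twistedTranslate l y) =
      ∫ z, twistedTranslateFun l y z * conj (twistedTranslateFun k x z) := fun k l => by
    rw [L2.inner_def]
    refine integral_congr_ae ?_
    filter_upwards [coeFn_twistedTranslate k x, coeFn_twistedTranslate l y] with z h1 h2
    rw [h1, h2, RCLike.inner_apply]
  refine ⟨fun m => inner ℂ (twistedTranslate m x) (twistedTranslate 0 y), fun k l => ?_⟩
  beta_reduce
  rw [hi, hi, ← integral_add_right_eq_self _ (latticePoint l)]
  refine integral_congr_ae (Eventually.of_forall fun z => ?_)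
  have e1 : z + latticePoint l - latticePoint k = z - latticePoint (k - l) := by
    simp only [latticePoint, Prod.fst_sub, Prod.snd_sub]
    push_cast
    ring
  have e2 : z - latticePoint 0 = z := by simp [latticePoint]
  simp only [twistedTranslateFun, map_mul, ← Complex.exp_conj, e1, e2, add_sub_cancel_right,
    Complex.conj_ofReal, Complex.conj_I]
  have e3 : ∀ a b c d : ℂ, a * b * (c * d) = (a * c) * (b * d) := fun a b c d => by ring
  simp only [e3, ← Complex.exp_add]
  congr 1
  rw [Complex.exp_eq_exp_iff_exists_int]
  refine ⟨k.1 * l.2 - k.2 * l.1, ?_⟩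
  simp only [latticePoint, Prod.fst_sub, Prod.snd_sub, Prod.fst_zero, Prod.snd_zero,
    Complex.add_re, Complex.add_im, Complex.intCast_re, Complex.intCast_im, Complex.mul_re,
    Complex.mul_im, Complex.I_re, Complex.I_im]
  push_cast
  ring

theorem twistedTranslate_zero (g : L2C) : twistedTranslate 0 g = g := by
  refine Lp.ext ((coeFn_twistedTranslate 0 g).trans (Eventually.of_forall fun z => ?_))
  simp [twistedTranslateFun, latticePoint]

/-- The perturbation bound at index 0 compares the pair with its image under W_v; both have the same
K, which makes the estimate uniform in v. -/
theorem WeylLip.of_isRieszDual {K : ℝ} (hK : 0 ≤ K) {g gd : L2C}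
    (h : IsRieszDual K (fun k => twistedTranslate k g) (fun k => twistedTranslate k gd))
    (hg : WeylLip g) : WeylLip gd := by
  obtain ⟨C, hC0, hC⟩ := hg
  refine ⟨K * C, by positivity, fun v => ?_⟩
  have h' : IsRieszDual K (fun k => twistedTranslate k (weyl v g))
      (fun k => twistedTranslate k (weyl v gd)) := by
    simp_rw [twistedTranslate_weyl]
    exact h.map hK (weylIsometry v) (weylPhase v) fun k => Complex.norm_exp_ofReal_mul_I _
  have hs := isShiftInvariant_twistedTranslate
  have := h'.norm_sub_le hK h (hs _ _) (hs _ _) (hs _ _) (hs _ _) (hs _ _) (hs _ _) 0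
  simp only [twistedTranslate_zero] at this
  calc _ ≤ K * ‖weyl v g - g‖ := this
    _ ≤ K * (C * ‖v‖) := by gcongr; exact hC v
    _ = _ := by ring

theorem weylLip_iff_of_isExactFrameFor {V : Submodule ℂ L2C} {g gd : L2C}
    (hV : IsClosed (V : Set L2C)) (hex : IsExactFrameFor V fun k : ℤ × ℤ => twistedTranslate k g)
    (hd : IsDualFunction V g gd) : WeylLip g ↔ WeylLip gd := by
  obtain ⟨K, hK, h⟩ := hex.exists_isRieszDual hV (fun x hx => (hd.2 x hx).1)
    fun x hx => (hd.2 x hx).2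
  exact ⟨WeylLip.of_isRieszDual hK h, WeylLip.of_isRieszDual hK h.symm⟩

/-! ### Fourier series on the two-dimensional torus -/

attribute [local instance] instMeasureSpaceUnitAddCircle

local instance instProbUnitAddCircle : IsProbabilityMeasure (volume : Measure UnitAddCircle) :=
  inferInstanceAs (IsProbabilityMeasure AddCircle.haarAddCircle)

local instance instHaarUnitAddCircle : Measure.IsAddHaarMeasure (volume : Measure UnitAddCircle) :=
  inferInstanceAs (Measure.IsAddHaarMeasure AddCircle.haarAddCircle)

/-- The two-dimensional torus. -/
abbrev Torus2 : Type := UnitAddTorus (Fin 2)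

/-- The frequency of the character `w ↦ exp(2πi Im(w k̄))`. -/
def torusFreq : ℤ × ℤ ≃ (Fin 2 → ℤ) where
  toFun k := ![-k.2, k.1]
  invFun n := (n 1, -n 0)
  left_inv k := by simp
  right_inv n := by
    ext i
    fin_cases i <;> simp

theorem torusFreq_add (k l : ℤ × ℤ) : torusFreq (k + l) = torusFreq k + torusFreq l := by
  ext i
  fin_cases i <;> simp [torusFreq]
  ring

/-- The Fourier coefficients of a function on the torus, indexed by lattice points. -/
def torusCoeff (f : Torus2 → ℂ) (k : ℤ × ℤ) : ℂ :=
  UnitAddTorus.mFourierCoeff f (torusFreq k)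

theorem torusCoeff_eq (f : Torus2 → ℂ) (k : ℤ × ℤ) :
    torusCoeff f k = ∫ θ, UnitAddTorus.mFourier (-torusFreq k) θ * f θ := rfl

theorem norm_mFourier_apply (n : Fin 2 → ℤ) (θ : Torus2) :
    ‖UnitAddTorus.mFourier n θ‖ = 1 := by
  simp [UnitAddTorus.mFourier, Circle.norm_coe]

theorem tsum_enorm_torusCoeff_sq {f : Torus2 → ℂ} (hf : MemLp f 2 volume) :
    ∑' k, ‖torusCoeff f k‖ₑ ^ 2 = ∫⁻ θ, ‖f θ‖ₑ ^ 2 := by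
  have h := UnitAddTorus.hasSum_sq_mFourierCoeff (hf.toLp f)
  have e1 : ∀ n, UnitAddTorus.mFourierCoeff (hf.toLp f) n = UnitAddTorus.mFourierCoeff f n :=
    fun n => integral_congr_ae (by
      filter_upwards [hf.coeFn_toLp] with θ hθ
      rw [hθ])
  have e2 : ∫ θ, ‖hf.toLp f θ‖ ^ 2 = ∫ θ, ‖f θ‖ ^ 2 := integral_congr_ae (by
    filter_upwards [hf.coeFn_toLp] with θ hθ
    rw [hθ])
  simp_rw [e1, e2] at h
  have e3 : ∑' k, ‖torusCoeff f k‖ₑ ^ 2 = ∑' n, ‖UnitAddTorus.mFourierCoeff f n‖ₑ ^ 2 :=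
    torusFreq.tsum_eq fun n => ‖UnitAddTorus.mFourierCoeff f n‖ₑ ^ 2
  have e4 : ∀ x : ℂ, ‖x‖ₑ ^ 2 = ENNReal.ofReal (‖x‖ ^ 2) := fun x => by
    rw [ENNReal.ofReal_pow (norm_nonneg _), ofReal_norm]
  rw [e3]
  simp_rw [e4]
  rw [← ENNReal.ofReal_tsum_of_nonneg (fun n => by positivity) h.summable, h.tsum_eq,
    ofReal_integral_eq_lintegral_ofReal _ (Eventually.of_forall fun θ => by positivity)]
  exact (memLp_two_iff_integrable_sq_norm hf.1).1 hf

/-- `a` and `b` are the Fourier coefficients of `f` and `1 / f̄` for some `f` with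
`A ≤ |f|² ≤ B`. -/
def IsZakFiber (A B : ℝ) (a b : ℤ × ℤ → ℂ) : Prop :=
  ∃ f : Torus2 → ℂ, AEStronglyMeasurable f volume ∧
    (∀ᵐ θ, A ≤ ‖f θ‖ ^ 2 ∧ ‖f θ‖ ^ 2 ≤ B) ∧
    (∀ k, a k = torusCoeff f k) ∧ ∀ k, b k = torusCoeff (fun θ => 1 / conj (f θ)) k

/-- Fibers are preserved by unimodular factors, translations and modulations. -/
theorem IsZakFiber.twist {A B : ℝ} {a b : ℤ × ℤ → ℂ} (h : IsZakFiber A B a b) {c : ℂ}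
    (hc : ‖c‖ = 1) (l : ℤ × ℤ) (τ : Torus2) :
    IsZakFiber A B (fun k => c * UnitAddTorus.mFourier (torusFreq k) τ * a (k + l))
      (fun k => c * UnitAddTorus.mFourier (torusFreq k) τ * b (k + l)) := by
  obtain ⟨f, hf, hb, ha, hb'⟩ := h
  have hcc : c * conj c = 1 := by
    rw [Complex.mul_conj, Complex.normSq_eq_norm_sq, hc]; simp
  have hτ : MeasurePreserving (fun θ : Torus2 => θ + τ) volume volume :=
    measurePreserving_add_right volume τ
  have key : ∀ (F : Torus2 → ℂ) (k : ℤ × ℤ),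
      c * UnitAddTorus.mFourier (torusFreq k) τ * torusCoeff F (k + l) =
      torusCoeff (fun θ => c * (UnitAddTorus.mFourier (-torusFreq l) (θ + τ) * F (θ + τ))) k :=
    fun F k => by
      rw [torusCoeff_eq, torusCoeff_eq, ← integral_add_right_eq_self _ τ, ← integral_const_mul]
      refine integral_congr_ae (Eventually.of_forall fun θ => ?_)
      have e1 : UnitAddTorus.mFourier (-torusFreq (k + l)) (θ + τ) =
          UnitAddTorus.mFourier (-torusFreq k) θ * UnitAddTorus.mFourier (-torusFreq k) τ *
            UnitAddTorus.mFourier (-torusFreq l) (θ + τ) := by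
        rw [torusFreq_add, neg_add, UnitAddTorus.mFourier_add]
        congr 1
        simp [UnitAddTorus.mFourier, AddCircle.toCircle_add]
        ring
      have e2 : UnitAddTorus.mFourier (torusFreq k) τ *
          UnitAddTorus.mFourier (-torusFreq k) τ = 1 := by
        rw [← UnitAddTorus.mFourier_add, add_neg_cancel, UnitAddTorus.mFourier_zero]
        rfl
      simp only [e1]
      linear_combination (c * UnitAddTorus.mFourier (-torusFreq k) θ *
        UnitAddTorus.mFourier (-torusFreq l) (θ + τ) * F (θ + τ)) * e2
  refine ⟨fun θ => c * (UnitAddTorus.mFourier (-torusFreq l) (θ + τ) * f (θ + τ)), ?_, ?_,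
    fun k => ?_, fun k => ?_⟩
  · refine AEStronglyMeasurable.const_mul (AEStronglyMeasurable.mul ?_
      (hf.comp_measurePreserving hτ)) c
    exact (((UnitAddTorus.mFourier (-torusFreq l)).continuous.comp
      (continuous_add_const τ))).aestronglyMeasurable
  · filter_upwards [hτ.quasiMeasurePreserving.ae hb] with θ hθ
    rwa [norm_mul, norm_mul, hc, norm_mFourier_apply, one_mul, one_mul]
  · beta_reduce
    rw [ha, key]
  · beta_reduce
    rw [hb', key]
    congr 1
    funext θ
    -- A unimodular u satisfies 1/ū = u, so these factors pass unchanged through f ↦ 1/f̄.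
    have e3 : UnitAddTorus.mFourier (-torusFreq l) (θ + τ) *
        conj (UnitAddTorus.mFourier (-torusFreq l) (θ + τ)) = 1 := by
      rw [Complex.mul_conj, Complex.normSq_eq_norm_sq, norm_mFourier_apply]; simp
    have h1 : conj c ≠ 0 := right_ne_zero_of_mul_eq_one hcc
    have h2 := right_ne_zero_of_mul_eq_one e3
    rw [map_mul, map_mul, one_div, one_div, mul_inv, mul_inv, ← eq_inv_of_mul_eq_one_left hcc,
      ← eq_inv_of_mul_eq_one_left e3]

theorem norm_inv_conj_sub_le {A : ℝ} (hA : 0 < A) {x y : ℂ} (hx : A ≤ ‖x‖ ^ 2)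
    (hy : A ≤ ‖y‖ ^ 2) : ‖1 / conj x - 1 / conj y‖ ≤ A⁻¹ * ‖x - y‖ := by
  have hx0 : x ≠ 0 := fun h => by simp [h] at hx; linarith
  have hy0 : y ≠ 0 := fun h => by simp [h] at hy; linarith
  have h1 : (1 : ℂ) / conj x - 1 / conj y = conj ((y - x) / (x * y)) := by
    have : conj x ≠ 0 := (map_ne_zero _).2 hx0
    have : conj y ≠ 0 := (map_ne_zero _).2 hy0
    rw [map_div₀, map_sub, map_mul]
    field_simp
  have h2 : A ≤ ‖x‖ * ‖y‖ := by
    refine le_of_sq_le_sq ?_ (by positivity)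
    rw [mul_pow, sq A]
    exact mul_le_mul hx hy hA.le (by positivity)
  rw [h1, RCLike.norm_conj, norm_div, norm_mul, norm_sub_rev, div_eq_inv_mul]
  gcongr

theorem memLp_of_norm_sq_le {f : Torus2 → ℂ} {B : ℝ} (hf : AEStronglyMeasurable f volume)
    (hB : ∀ᵐ θ, ‖f θ‖ ^ 2 ≤ B) : MemLp f 2 volume := by
  refine MemLp.of_bound hf (√B) ?_
  filter_upwards [hB] with θ hθ
  exact Real.le_sqrt_of_sq_le hθ

theorem aestronglyMeasurable_one_div_conj {α : Type*} [MeasurableSpace α] {μ : Measure α}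
    {f : α → ℂ} (hf : AEStronglyMeasurable f μ) :
    AEStronglyMeasurable (fun θ => 1 / conj (f θ)) μ := by
  have := (Complex.continuous_conj.comp_aestronglyMeasurable hf).inv₀
  simp only [one_div]
  exact this

theorem norm_one_div_conj_sq_le {A : ℝ} (hA : 0 < A) {x : ℂ} (hx : A ≤ ‖x‖ ^ 2) :
    ‖1 / conj x‖ ^ 2 ≤ A⁻¹ := by
  rw [one_div, norm_inv, RCLike.norm_conj, inv_pow]
  gcongr

theorem torusCoeff_sub {f h : Torus2 → ℂ} (hf : MemLp f 2 volume) (hh : MemLp h 2 volume)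
    (k : ℤ × ℤ) : torusCoeff f k - torusCoeff h k = torusCoeff (fun θ => f θ - h θ) k := by
  have hi : ∀ F : Torus2 → ℂ, MemLp F 2 volume →
      Integrable (fun θ => UnitAddTorus.mFourier (-torusFreq k) θ * F θ) volume := fun F hF =>
    (hF.integrable (by norm_num)).bdd_mul (c := 1)
      (UnitAddTorus.mFourier (-torusFreq k)).continuous.aestronglyMeasurable
      (Eventually.of_forall fun θ => (norm_mFourier_apply _ θ).le)
  rw [torusCoeff_eq, torusCoeff_eq, torusCoeff_eq, ← integral_sub (hi f hf) (hi h hh)]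
  simp_rw [mul_sub]

/-- Parseval turns both sums into integrals over the torus, where x ↦ 1/x̄ is Lipschitz with
constant A⁻¹ on |x|² ≥ A. -/
theorem IsZakFiber.tsum_le {A B : ℝ} (hA : 0 < A) {a b a' b' : ℤ × ℤ → ℂ}
    (h : IsZakFiber A B a b) (h' : IsZakFiber A B a' b') :
    ∑' k, ‖b' k - b k‖ₑ ^ 2 ≤ ENNReal.ofReal A⁻¹ ^ 2 * ∑' k, ‖a' k - a k‖ₑ ^ 2 := by
  obtain ⟨f, hf, hfb, ha, hb⟩ := h
  obtain ⟨f', hf', hfb', ha', hb'⟩ := h'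
  have m1 : MemLp f 2 volume := memLp_of_norm_sq_le hf (hfb.mono fun _ h => h.2)
  have m1' : MemLp f' 2 volume := memLp_of_norm_sq_le hf' (hfb'.mono fun _ h => h.2)
  have m2 : MemLp (fun θ => 1 / conj (f θ)) 2 volume :=
    memLp_of_norm_sq_le (aestronglyMeasurable_one_div_conj hf)
      (hfb.mono fun _ h => norm_one_div_conj_sq_le hA h.1)
  have m2' : MemLp (fun θ => 1 / conj (f' θ)) 2 volume :=
    memLp_of_norm_sq_le (aestronglyMeasurable_one_div_conj hf')
      (hfb'.mono fun _ h => norm_one_div_conj_sq_le hA h.1)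
  have d1 : MemLp (fun θ => f' θ - f θ) 2 volume := m1'.sub m1
  have d2 : MemLp (fun θ => 1 / conj (f' θ) - 1 / conj (f θ)) 2 volume := m2'.sub m2
  simp_rw [ha, hb, ha', hb', torusCoeff_sub m1' m1, torusCoeff_sub m2' m2]
  rw [tsum_enorm_torusCoeff_sq d1, tsum_enorm_torusCoeff_sq d2,
    ← lintegral_const_mul' _ _ (by finiteness)]
  refine lintegral_mono_ae ?_
  filter_upwards [hfb, hfb'] with θ h1 h2
  rw [← mul_pow]
  gcongr
  rw [← ofReal_norm, ← ofReal_norm, ← ENNReal.ofReal_mul (by positivity)]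
  exact ENNReal.ofReal_le_ofReal (norm_inv_conj_sub_le hA h2.1 h1.1)

theorem torusCoeff_trigPolynomial (c : ℤ × ℤ → ℂ) {s : Finset (ℤ × ℤ)} {k : ℤ × ℤ} (hk : k ∈ s) :
    torusCoeff (fun θ => ∑ j ∈ s, c j * UnitAddTorus.mFourier (torusFreq j) θ) k = c k := by
  classical
  have horth : ∀ j, ∫ θ, UnitAddTorus.mFourier (-torusFreq k) θ *
      UnitAddTorus.mFourier (torusFreq j) θ = if k = j then 1 else 0 := fun j => by
    have h := (orthonormal_iff_ite.1 (UnitAddTorus.orthonormal_mFourier (d := Fin 2)))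
      (torusFreq k) (torusFreq j)
    simp only [EmbeddingLike.apply_eq_iff_eq] at h
    rw [← h, UnitAddTorus.mFourierLp, ContinuousMap.inner_toLp]
    refine integral_congr_ae (Eventually.of_forall fun θ => ?_)
    simp only [UnitAddTorus.mFourier_neg]
    ring
  rw [torusCoeff_eq]
  simp_rw [Finset.mul_sum]
  rw [integral_finsetSum]
  · have : ∀ j, ∫ θ, UnitAddTorus.mFourier (-torusFreq k) θ *
        (c j * UnitAddTorus.mFourier (torusFreq j) θ) = c j * if k = j then 1 else 0 := fun j => by
      rw [← horth, ← integral_const_mul]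
      congr 1 with θ
      ring
    simp [this, hk]
  · intro j _
    refine Continuous.integrable_of_hasCompactSupport ?_ (HasCompactSupport.of_compactSpace _)
    fun_prop

/-! ### The unit square as a torus -/

/-- A point of the torus as a point of the unit square, up to the boundary. -/
def torusToSquare (θ : Torus2) : ℂ :=
  Complex.measurableEquivPi.symm
    ((UnitAddTorus.measurableEquivPiIoc (0 : Fin 2 → ℝ) θ : Fin 2 → ℝ))

theorem measurableSet_unitSquare : MeasurableSet unitSquare :=
  (Complex.measurable_re measurableSet_Ico).inter (Complex.measurable_im measurableSet_Ico)

theorem measurePreserving_torusToSquare :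
    MeasurePreserving torusToSquare volume (volume.restrict unitSquare) := by
  have h1 := UnitAddTorus.measurePreserving_equivPiIoc (d := Fin 2) 0
  have hs : MeasurableSet {x : Fin 2 → ℝ | ∀ i, x i ∈ Set.Ioc ((0 : Fin 2 → ℝ) i)
      ((0 : Fin 2 → ℝ) i + 1)} := MeasurableSet.univ_pi' fun i => measurableSet_Ioc
  have h2 := measurePreserving_subtype_coe (μa := (volume : Measure (Fin 2 → ℝ))) hs
  have h3 := (Complex.volume_preserving_equiv_pi.symm).restrict_preimage measurableSet_unitSquare
  have h4 : (volume : Measure (Fin 2 → ℝ)).restrict {x : Fin 2 → ℝ | ∀ i,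
      x i ∈ Set.Ioc ((0 : Fin 2 → ℝ) i) ((0 : Fin 2 → ℝ) i + 1)} =
      volume.restrict (Complex.measurableEquivPi.symm ⁻¹' unitSquare) := by
    -- The torus is cut along (0, 1] and the square along [0, 1); both cubes agree with the closed
    -- cube up to a null set.
    refine Measure.restrict_congr_set ?_
    have e1 : {x : Fin 2 → ℝ | ∀ i, x i ∈ Set.Ioc ((0 : Fin 2 → ℝ) i)
        ((0 : Fin 2 → ℝ) i + 1)} = Set.univ.pi fun i => Set.Ioc ((0 : Fin 2 → ℝ) i)
        ((0 + 1 : Fin 2 → ℝ) i) := by ext x; simp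
    have e2 : Complex.measurableEquivPi.symm ⁻¹' unitSquare =
        Set.univ.pi fun i => Set.Ico ((0 : Fin 2 → ℝ) i) ((0 + 1 : Fin 2 → ℝ) i) := by
      ext x
      simp [unitSquare, Complex.measurableEquivPi_symm_apply]
    rw [e1, e2]
    exact (Measure.univ_pi_Ioc_ae_eq_Icc).trans (Measure.univ_pi_Ico_ae_eq_Icc).symm
  rw [← h4] at h3
  exact h3.comp (h2.comp h1)

theorem mFourier_torusFreq_coe (k : ℤ × ℤ) (x : Fin 2 → ℝ) :
    UnitAddTorus.mFourier (torusFreq k) (fun i => (x i : UnitAddCircle)) =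
      Complex.exp (((2 * Real.pi * (k.1 * x 1 - k.2 * x 0) : ℝ) : ℂ) * Complex.I) := by
  simp only [UnitAddTorus.mFourier, ContinuousMap.coe_mk, Fin.prod_univ_two, torusFreq,
    Equiv.coe_fn_mk, fourier_coe_apply]
  rw [← Complex.exp_add]
  congr 1
  push_cast
  simp
  ring

theorem exp_torusToSquare (k : ℤ × ℤ) (θ : Torus2) :
    Complex.exp (((2 * Real.pi * (torusToSquare θ * conj (latticePoint k)).im : ℝ) : ℂ) *
      Complex.I) = UnitAddTorus.mFourier (torusFreq k) θ := by
  obtain ⟨x, rfl⟩ := (UnitAddTorus.measurableEquivPiIoc (0 : Fin 2 → ℝ)).symm.surjective θ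
  have h : torusToSquare ((UnitAddTorus.measurableEquivPiIoc (0 : Fin 2 → ℝ)).symm x) =
      Complex.mk (x.1 0) (x.1 1) := by
    rw [torusToSquare, MeasurableEquiv.apply_symm_apply, Complex.measurableEquivPi_symm_apply]
    apply Complex.ext <;> simp
  rw [h, UnitAddTorus.coe_symm_measurableEquivPiIoc_apply, mFourier_torusFreq_coe]
  congr 4
  simp [latticePoint]
  ring

theorem zakMeasure_eq :
    zakMeasure = (volume.restrict unitSquare).prod (volume.restrict unitSquare) := by
  rw [zakMeasure, Measure.volume_eq_prod, Measure.prod_restrict]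

theorem measurePreserving_prodMap_torusToSquare :
    MeasurePreserving (Prod.map id torusToSquare : ℂ × Torus2 → ℂ × ℂ)
      ((volume.restrict unitSquare).prod volume) zakMeasure := by
  rw [zakMeasure_eq]
  exact (MeasurePreserving.id _).prod measurePreserving_torusToSquare

theorem aestronglyMeasurable_zakTerm (f : L2C) (k : ℤ × ℤ) :
    AEStronglyMeasurable (zakTerm f k) zakMeasure := by
  refine AEStronglyMeasurable.mul ?_ (Continuous.aestronglyMeasurable (by fun_prop))
  have h : AEStronglyMeasurable (fun z : ℂ => f (z - latticePoint k)) volume :=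
    (Lp.aestronglyMeasurable f).comp_measurePreserving
      (measurePreserving_sub_right volume (latticePoint k))
  rw [zakMeasure_eq]
  exact h.restrict.comp_fst

/-- The Fourier coefficients of almost every slice of the twisted Zak transform are the values
of the function along a lattice. -/
theorem IsTwistedZak.torusCoeff_ae_eq {g : L2C} {G : ℂ × ℂ → ℂ} (h : IsTwistedZak g G) {B : ℝ}
    (hB : ∀ᵐ p ∂zakMeasure, ‖G p‖ ^ 2 ≤ B) (k : ℤ × ℤ) :
    ∀ᵐ z ∂volume.restrict unitSquare,
      torusCoeff (fun θ => G (z, torusToSquare θ)) k = g (z - latticePoint k) := by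
  classical
  obtain ⟨hG, hlim⟩ := h
  set μ : Measure ℂ := volume.restrict unitSquare
  have hψ := measurePreserving_prodMap_torusToSquare
  have hm : AEStronglyMeasurable (fun p : ℂ × Torus2 => G (p.1, torusToSquare p.2))
      (μ.prod volume) := hG.1.comp_measurePreserving hψ
  have hslice : ∀ᵐ z ∂μ, MemLp (fun θ => G (z, torusToSquare θ)) 2 volume := by
    have hb := Measure.ae_ae_of_ae_prod (hψ.quasiMeasurePreserving.ae hB)
    filter_upwards [hb, hm.prodMk_left] with z h1 h2
    exact memLp_of_norm_sq_le h2 h1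
  -- On a slice the partial sum is a trigonometric polynomial with k-th coefficient g(z - k).
  -- Parseval bounds one coefficient of the difference by its L² norm, and integrating over z gives
  -- the norm on Q × Q.
  have hbound : ∀ s : Finset (ℤ × ℤ), k ∈ s →
      ∫⁻ z, ‖torusCoeff (fun θ => G (z, torusToSquare θ)) k - g (z - latticePoint k)‖ₑ ^ 2 ∂μ ≤
        eLpNorm (fun p => G p - ∑ j ∈ s, zakTerm g j p) 2 zakMeasure ^ 2 := fun s hs => by
    have hms : AEStronglyMeasurable (fun p => G p - ∑ j ∈ s, zakTerm g j p) zakMeasure :=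
      hG.1.sub (Finset.aestronglyMeasurable_fun_sum s fun j _ => aestronglyMeasurable_zakTerm g j)
    rw [← eLpNorm_comp_measurePreserving hms hψ, eLpNorm_two_sq]
    rw [lintegral_prod _ ((hms.comp_measurePreserving hψ).enorm.pow_const 2)]
    refine lintegral_mono_ae ?_
    filter_upwards [hslice] with z hz
    set S : Torus2 → ℂ := fun θ =>
      ∑ j ∈ s, g (z - latticePoint j) * UnitAddTorus.mFourier (torusFreq j) θ with hS
    have hSm : MemLp S 2 volume := by
      have hc : Continuous S := by fun_prop
      exact hc.memLp_of_hasCompactSupport (HasCompactSupport.of_compactSpace _)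
    have e1 : g (z - latticePoint k) = torusCoeff S k :=
      (torusCoeff_trigPolynomial (fun j => g (z - latticePoint j)) hs).symm
    have e2 : ∀ θ, (fun p => G p - ∑ j ∈ s, zakTerm g j p) (Prod.map id torusToSquare (z, θ)) =
        G (z, torusToSquare θ) - S θ := fun θ => by
      simp only [Prod.map_apply, id_eq, zakTerm, exp_torusToSquare, hS]
    have hd : MemLp (fun θ => G (z, torusToSquare θ) - S θ) 2 volume := hz.sub hSm
    rw [e1, torusCoeff_sub hz hSm]
    simp only [Function.comp_apply, e2]
    rw [← tsum_enorm_torusCoeff_sq hd]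
    exact ENNReal.le_tsum k
  have hzero : ∫⁻ z, ‖torusCoeff (fun θ => G (z, torusToSquare θ)) k -
      g (z - latticePoint k)‖ₑ ^ 2 ∂μ = 0 := by
    have hl : Tendsto (fun s : Finset (ℤ × ℤ) =>
        eLpNorm (fun p => G p - ∑ j ∈ s, zakTerm g j p) 2 zakMeasure ^ 2) atTop (𝓝 0) := by
      simpa using ENNReal.Tendsto.pow (n := 2) hlim
    refine le_antisymm (ge_of_tendsto hl ?_) bot_le
    filter_upwards [eventually_ge_atTop {k}] with s hs
    exact hbound s (hs (Finset.mem_singleton_self k))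
  have hmeas : AEMeasurable (fun z => ‖torusCoeff (fun θ => G (z, torusToSquare θ)) k -
      g (z - latticePoint k)‖ₑ ^ 2) μ := by
    refine (AEStronglyMeasurable.enorm (AEStronglyMeasurable.sub ?_ ?_)).pow_const 2
    · have hF : AEStronglyMeasurable (fun p : ℂ × Torus2 =>
          UnitAddTorus.mFourier (-torusFreq k) p.2 * G (p.1, torusToSquare p.2)) (μ.prod volume) :=
        (Continuous.aestronglyMeasurable (by fun_prop)).mul hm
      exact hF.integral_prod_right'
    · exact ((Lp.aestronglyMeasurable g).comp_measurePreserving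
        (measurePreserving_sub_right volume (latticePoint k))).restrict
  filter_upwards [(lintegral_eq_zero_iff' hmeas).1 hzero] with z hz
  simpa [sub_eq_zero] using hz

/-! ### Fibers of a function and its dual -/

/-- The fibers over `z` of `g` and `gd` are Fourier coefficients of `f` and `1 / f̄`. -/
def IsZakFiberAt (A B : ℝ) (g gd : ℂ → ℂ) (z : ℂ) : Prop :=
  IsZakFiber A B (fun k => g (z - latticePoint k)) (fun k => gd (z - latticePoint k))

theorem ae_isZakFiberAt_unitSquare {g gd : L2C} {G : ℂ × ℂ → ℂ} {A B : ℝ} (hA : 0 < A)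
    (hg : IsTwistedZak g G) (hG : ∀ᵐ p ∂zakMeasure, A ≤ ‖G p‖ ^ 2 ∧ ‖G p‖ ^ 2 ≤ B)
    (hgd : IsTwistedZak gd (fun p => 1 / conj (G p))) :
    ∀ᵐ z ∂volume.restrict unitSquare, IsZakFiberAt A B g gd z := by
  have hψ := measurePreserving_prodMap_torusToSquare
  have hm : AEStronglyMeasurable (fun p : ℂ × Torus2 => G (p.1, torusToSquare p.2))
      ((volume.restrict unitSquare).prod volume) := hg.1.1.comp_measurePreserving hψ
  have hb := Measure.ae_ae_of_ae_prod (hψ.quasiMeasurePreserving.ae hG)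
  have h1 := ae_all_iff.2 (hg.torusCoeff_ae_eq (hG.mono fun _ h => h.2))
  have h2 := ae_all_iff.2 (hgd.torusCoeff_ae_eq (hG.mono fun _ h =>
    norm_one_div_conj_sq_le hA h.1))
  filter_upwards [hm.prodMk_left, hb, h1, h2] with z z1 z2 z3 z4
  exact ⟨_, z1, z2, fun k => (z3 k).symm, fun k => (z4 k).symm⟩

theorem latticePoint_add (k l : ℤ × ℤ) :
    latticePoint (k + l) = latticePoint k + latticePoint l := by
  simp only [latticePoint, Prod.fst_add, Prod.snd_add]
  push_cast
  ring

theorem add_latticePoint_mem_unitSquare_iff (z : ℂ) (k : ℤ × ℤ) :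
    z + latticePoint k ∈ unitSquare ↔ k = (-⌊z.re⌋, -⌊z.im⌋) := by
  have h : ∀ (x : ℝ) (n : ℤ), (0 ≤ x + n ∧ x + n < 1) ↔ n = -⌊x⌋ := fun x n => by
    rw [← neg_eq_iff_eq_neg, eq_comm (a := -n), Int.floor_eq_iff]
    push_cast
    constructor <;> rintro ⟨h1, h2⟩ <;> constructor <;> linarith
  rw [Prod.ext_iff, ← h, ← h]
  simp [unitSquare, latticePoint]

/-- Moving the base point by a lattice vector reindexes the coefficients, which multiplies f by a
character. -/
theorem IsZakFiberAt.of_add {A B : ℝ} {g gd : ℂ → ℂ} {z : ℂ} {l : ℤ × ℤ}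
    (h : IsZakFiberAt A B g gd (z + latticePoint l)) : IsZakFiberAt A B g gd z := by
  have := IsZakFiber.twist h norm_one l 0
  have e0 : ∀ n : Fin 2 → ℤ, UnitAddTorus.mFourier n 0 = 1 := fun n => by
    simp [UnitAddTorus.mFourier]
  simpa only [IsZakFiberAt, e0, one_mul, latticePoint_add, add_sub_add_right_eq_sub] using this

/-- Every z has a lattice translate in Q, and countably many translates of a null set are still
null. -/
theorem ae_isZakFiberAt {g gd : L2C} {G : ℂ × ℂ → ℂ} {A B : ℝ} (hA : 0 < A)
    (hg : IsTwistedZak g G) (hG : ∀ᵐ p ∂zakMeasure, A ≤ ‖G p‖ ^ 2 ∧ ‖G p‖ ^ 2 ≤ B)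
    (hgd : IsTwistedZak gd (fun p => 1 / conj (G p))) :
    ∀ᵐ z : ℂ, IsZakFiberAt A B g gd z := by
  have h := (ae_restrict_iff' measurableSet_unitSquare).1
    (ae_isZakFiberAt_unitSquare hA hg hG hgd)
  have h' : ∀ᵐ z : ℂ, ∀ l : ℤ × ℤ, z + latticePoint l ∈ unitSquare →
      IsZakFiberAt A B g gd (z + latticePoint l) := ae_all_iff.2 fun l =>
    (measurePreserving_add_right volume (latticePoint l)).quasiMeasurePreserving.ae h
  filter_upwards [h'] with z hz
  exact (hz _ ((add_latticePoint_mem_unitSquare_iff z _).2 rfl)).of_add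

/-! ### Periodization and the Weyl action on fibers -/

/-- Integration over the plane, lattice translate by lattice translate. -/
theorem lintegral_eq_setLIntegral_tsum {F : ℂ → ENNReal} (hF : AEMeasurable F volume) :
    ∫⁻ z, F z = ∫⁻ z in unitSquare, ∑' k, F (z - latticePoint k) := by
  classical
  have hF' : ∀ k, AEMeasurable (fun z => F (z - latticePoint k)) volume := fun k =>
    hF.comp_quasiMeasurePreserving
      (measurePreserving_sub_right volume (latticePoint k)).quasiMeasurePreserving
  have hQ : ∀ k, MeasurableSet ((fun z => z + latticePoint k) ⁻¹' unitSquare) := fun k =>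
    measurableSet_unitSquare.preimage (measurable_add_const _)
  rw [lintegral_tsum fun k => (hF' k).restrict]
  have e : ∀ k, ∫⁻ z in unitSquare, F (z - latticePoint k) =
      ∫⁻ z, ((fun z => z + latticePoint k) ⁻¹' unitSquare).indicator F z := fun k => by
    rw [← lintegral_indicator measurableSet_unitSquare,
      ← lintegral_add_right_eq_self _ (latticePoint k)]
    refine lintegral_congr fun z => ?_
    by_cases hz : z + latticePoint k ∈ unitSquare <;> simp [hz]
  simp_rw [e]
  rw [← lintegral_tsum fun k => hF.indicator (hQ k)]
  refine lintegral_congr fun z => ?_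
  rw [tsum_eq_single (-⌊z.re⌋, -⌊z.im⌋) fun k hk => ?_]
  · rw [Set.indicator_of_mem]
    exact (add_latticePoint_mem_unitSquare_iff z _).2 rfl
  · rw [Set.indicator_of_notMem]
    exact fun h => hk ((add_latticePoint_mem_unitSquare_iff z k).1 h)

/-- Along a lattice coset the Weyl phase is a constant times a character of k, evaluated at the
torus point -(Re v, Im v)/2π. On fibers W_v is therefore a scalar and a translation of the torus. -/
theorem weylFun_sub_latticePoint (v : ℂ) (f : ℂ → ℂ) (z : ℂ) (k : ℤ × ℤ) :
    weylFun v f (z - latticePoint k) =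
      Complex.exp ((((conj z * v).im : ℝ) : ℂ) * Complex.I) *
        UnitAddTorus.mFourier (torusFreq k)
          (fun i => ((![-v.re, -v.im] i / (2 * Real.pi) : ℝ) : UnitAddCircle)) *
        f (z + v - latticePoint k) := by
  rw [mFourier_torusFreq_coe, ← Complex.exp_add, weylFun, sub_add_eq_add_sub, ← add_mul]
  congr 3
  rw [← Complex.ofReal_add]
  congr 1
  have := Real.pi_pos
  simp [latticePoint]
  field_simp
  ring

theorem IsZakFiberAt.weylFun {A B : ℝ} {g gd : ℂ → ℂ} {z v : ℂ}
    (h : IsZakFiberAt A B g gd (z + v)) :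
    IsZakFiberAt A B (weylFun v g) (weylFun v gd) z := by
  have := IsZakFiber.twist h (Complex.norm_exp_ofReal_mul_I (conj z * v).im) 0
    (fun i => ((![-v.re, -v.im] i / (2 * Real.pi) : ℝ) : UnitAddCircle))
  simp only [add_zero] at this
  simpa only [IsZakFiberAt, weylFun_sub_latticePoint] using this

/-- W_v carries the fiber over z + v to one over z with the same bounds. Comparing it with the
original fiber over z and integrating over Q gives ‖W_v gd - gd‖ ≤ A⁻¹‖W_v g - g‖. -/
theorem weylLip_of_ae_isZakFiberAt {g gd : L2C} {A B : ℝ} (hA : 0 < A)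
    (h : ∀ᵐ z : ℂ, IsZakFiberAt A B g gd z) (hg : WeylLip g) : WeylLip gd := by
  obtain ⟨C, hC, hCv⟩ := hg
  refine ⟨A⁻¹ * C, by positivity, fun v => ?_⟩
  have hmeas : ∀ f : L2C, AEMeasurable (fun z => ‖weylFun v f z - f z‖ₑ ^ 2) volume := fun f =>
    ((aestronglyMeasurable_weylFun v (Lp.aestronglyMeasurable f)).sub
      (Lp.aestronglyMeasurable f)).enorm.pow_const 2
  have hv : ∀ᵐ z : ℂ, IsZakFiberAt A B g gd (z + v) :=
    (measurePreserving_add_right volume v).quasiMeasurePreserving.ae h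
  have key : ENNReal.ofReal ‖weyl v gd - gd‖ ≤ ENNReal.ofReal A⁻¹ *
      ENNReal.ofReal ‖weyl v g - g‖ := by
    rw [← (ENNReal.pow_right_strictMono (n := 2) two_ne_zero).le_iff_le, mul_pow,
      enorm_weyl_sub, enorm_weyl_sub, eLpNorm_two_sq, eLpNorm_two_sq,
      lintegral_eq_setLIntegral_tsum (hmeas gd), lintegral_eq_setLIntegral_tsum (hmeas g),
      ← lintegral_const_mul' _ _ (by finiteness)]
    refine lintegral_mono_ae (ae_restrict_of_ae ?_)
    filter_upwards [h, hv] with z h1 h2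
    exact IsZakFiber.tsum_le hA h1 h2.weylFun
  rw [← ENNReal.ofReal_mul (by positivity)] at key
  have := (ENNReal.ofReal_le_ofReal_iff (by positivity)).1 key
  calc ‖weyl v gd - gd‖ ≤ A⁻¹ * ‖weyl v g - g‖ := this
    _ ≤ A⁻¹ * (C * ‖v‖) := by gcongr; exact hCv v
    _ = A⁻¹ * C * ‖v‖ := by ring

theorem weylLip_iff_of_isTwistedZak {g gd : L2C} {G : ℂ × ℂ → ℂ} {A B : ℝ} (hA : 0 < A)
    (hB : 0 < B) (hg : IsTwistedZak g G)
    (hG : ∀ᵐ p ∂zakMeasure, A ≤ ‖G p‖ ^ 2 ∧ ‖G p‖ ^ 2 ≤ B)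
    (hgd : IsTwistedZak gd (fun p => 1 / conj (G p))) : WeylLip g ↔ WeylLip gd := by
  refine ⟨weylLip_of_ae_isZakFiberAt hA (ae_isZakFiberAt hA hg hG hgd),
    -- The converse exchanges the roles: the map f ↦ 1/f̄ is an involution and turns the bounds A, B
    -- into B⁻¹, A⁻¹.
    weylLip_of_ae_isZakFiberAt (A := B⁻¹) (inv_pos.2 hB)
      (ae_isZakFiberAt (B := A⁻¹) (inv_pos.2 hB) hgd ?_ ?_)⟩
  · filter_upwards [hG] with p hp
    refine ⟨?_, norm_one_div_conj_sq_le hA hp.1⟩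
    have : 0 < ‖G p‖ ^ 2 := hA.trans_le hp.1
    rw [one_div, norm_inv, RCLike.norm_conj, inv_pow]
    exact inv_anti₀ this hp.2
  · simpa using hg

end

/-! ### The duality theorem in both settings -/

theorem theorem5p5 :
    -- exact twisted Gabor frames for a closed subspace, in particular (`V = ⊤`) for `L²(ℂ)`
    (∀ (V : Submodule ℂ L2C) (g gd : L2C), IsClosed (V : Set L2C) →
      IsExactFrameFor V (fun k : ℤ × ℤ => twistedTranslate k g) →
      IsDualFunction V g gd →
      (ZbarMemL2 g ↔ ZMemL2 gd) ∧ (ZMemL2 g ↔ ZbarMemL2 gd)) ∧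
    -- twisted Zak transform bounded above and below, dual function given by `1 / conj`
    (∀ (g gd : L2C) (G : ℂ × ℂ → ℂ), IsTwistedZak g G →
      (∃ A B : ℝ, 0 < A ∧ 0 < B ∧
        ∀ᵐ p ∂zakMeasure, A ≤ ‖G p‖ ^ 2 ∧ ‖G p‖ ^ 2 ≤ B) →
      IsTwistedZak gd (fun p => 1 / conj (G p)) →
      (ZbarMemL2 g ↔ ZMemL2 gd) ∧ (ZMemL2 g ↔ ZbarMemL2 gd)) := by
  refine ⟨fun V g gd hV hex hd => ?_, fun g gd G hg ⟨A, B, hA, hB, hG⟩ hgd => ?_⟩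
  · have h := weylLip_iff_of_isExactFrameFor hV hex hd
    -- Z and Z̄ give the same condition `WeylLip`, so both equivalences reduce to `h`.
    simp only [zMemL2_iff_weylLip, zbarMemL2_iff_weylLip, h, and_self]
  · have h := weylLip_iff_of_isTwistedZak hA hB hg hG hgd
    simp only [zMemL2_iff_weylLip, zbarMemL2_iff_weylLip, h, and_self]
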